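/- Let $\mathbb{T}^2=\mathbb{R}^2/\mathbb{Z}^2$, let $F_2(\mathbb{T}^2)=\{(a,b)\in\mathbb{T}^2\times\mathbb{T}^2 : a\neq b\}$, let $D_2(\mathbb{T}^2)$ be its quotient by the involution $(a,b)\mapsto(b,a)$, and let $p_1:F_2(\mathbb{T}^2)\to\mathbb{T}^2$ be the projection onto the first coordinate. Let $n_1\neq n_2$ be points of $\mathbb{T}^2$, and put $P_2(\mathbb{T}^2)=\pi_1(F_2(\mathbb{T}^2),(n_1,n_2))$ and $B_2(\mathbb{T}^2)=\pi_1(D_2(\mathbb{T}^2),\{n_1,n_2\})$; in fundamental groups the product $\alpha\beta$ means first $\beta$, then $\alpha$. Choose $v\in\mathbb{R}^2$ with $|v|<1$ and $n_2=n_1+v$ in $\mathbb{T}^2$ (such a $v$ always exists), and let $\sigma\in B_2(\mathbb{T}^2)$ be the standard generator that swaps the two base points, i.e. the class of the loop in $D_2(\mathbb{T}^2)$ that rotates $n_1$ and $n_2$ counterclockwise through the angle $\pi$ about the midpoint $n_1+v/2$. Then the homomorphism $P_2(\mathbb{T}^2)\to B_2(\mathbb{T}^2)$ induced by the quotient map is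 injective, so that $P_2(\mathbb{T}^2)$ may be regarded as a subgroup of $B_2(\mathbb{T}^2)$. Moreover, with $\pi_1(\mathbb{T}^2,n_1)$ identified with $\mathbb{Z}\oplus\mathbb{Z}$ so that the loops $t\mapsto n_1+(t,0)$ and $t\mapsto n_1+(0,t)$ correspond to $(1,0)$ and $(0,1)$, there is an isomorphism $$P_2(\mathbb{T}^2)\;\cong\; F(x,y)\oplus\mathbb{Z}\oplus\mathbb{Z},$$ where $F(x,y)$ is the free group on $\{x,y\}$ with trivial element $\mathbb{1}$, relative to which: (a) the homomorphism $(p_1)_\#:P_2(\mathbb{T}^2)\to\pi_1(\mathbb{T}^2,n_1)=\mathbb{Z}\oplus\mathbb{Z}$ is the projection $(p_1)_\#(w,m,n)=(m,n)$ for all $w\in F(x,y)$ and $m,n\in\mathbb{Z}$; (b) $\sigma\in B_2(\mathbb{T}^2)\setminus P_2(\mathbb{T}^2)$ and $\sigma^2=(B,0,0)$, where $B=[x,y^{-1}]=xy^{-1}x^{-1}y$; (c) $g\mapsto\sigma g\sigma^{-1}$ defines a homomorphism $l_\sigma:P_2(\mathbb{T}^2)\to P_2(\mathbb{T}^2)$,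 and $l_\sigma(x,0,0)=(Bx^{-1},1,0)$, $l_\sigma(y,0,0)=(By^{-1},0,1)$, $l_\sigma(\mathbb{1},1,0)=(\mathbb{1},1,0)$ and $l_\sigma(\mathbb{1},0,1)=(\mathbb{1},0,1)$. -/

import Mathlib

noncomputable section

namespace TorusBraid

/-- The ordered configuration space `F₂(N)` of pairs of distinct points of `N`. -/
abbrev Conf (N : Type*) : Type _ := {p : N × N // p.1 ≠ p.2}

/-- The free involution of `F₂(N)` exchanging the two points. -/
def swap {N : Type*} (p : Conf N) : Conf N := ⟨(p.1.2, p.1.1), p.2.symm⟩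

/-- The orbit relation of the involution `swap`. -/
instance swapSetoid (N : Type*) : Setoid (Conf N) where
  r p q := p = q ∨ p = swap q
  iseqv := by
    refine ⟨fun _ => Or.inl rfl, ?_, ?_⟩
    · rintro p q (rfl | rfl)
      · exact Or.inl rfl
      · exact Or.inr rfl
    · rintro p q r (rfl | rfl) (rfl | rfl)
      · exact Or.inl rfl
      · exact Or.inr rfl
      · exact Or.inr rfl
      · exact Or.inl rfl

/-- The unordered configuration space `D₂(N)`, the orbit space of `F₂(N)` under `swap`, with the
quotient topology. -/
abbrev UConf (N : Type*) : Type _ := Quotient (swapSetoid N)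

/-- The orbit projection `F₂(N) → D₂(N)`. -/
def confProj (N : Type*) [TopologicalSpace N] : C(Conf N, UConf N) :=
  ⟨Quotient.mk _, continuous_quotient_mk'⟩

/-- The projection `p₁ : F₂(N) → N` onto the first coordinate. -/
def firstPoint (N : Type*) [TopologicalSpace N] : C(Conf N, N) :=
  ⟨fun p => p.1.1, by fun_prop⟩

/-- The pure 2-string braid group `P₂(N) = π₁(F₂(N), n)`. In Mathlib's fundamental group the
product `p * q` is the class of the loop that first runs along `q` and then along `p`. -/
abbrev PureBraid {N : Type*} [TopologicalSpace N] (n : Conf N) : Type _ :=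
  FundamentalGroup (Conf N) n

/-- The full 2-string braid group `B₂(N) = π₁(D₂(N), {n₁, n₂})`. -/
abbrev FullBraid {N : Type*} [TopologicalSpace N] (n : Conf N) : Type _ :=
  FundamentalGroup (UConf N) (confProj N n)

/-- The homomorphism `P₂(N) → B₂(N)` induced by the orbit projection. -/
def pureToFull {N : Type*} [TopologicalSpace N] (n : Conf N) : PureBraid n →* FullBraid n :=
  FundamentalGroup.map (confProj N) n

/-- The homomorphism `(p₁)_# : P₂(N) → π₁(N, n₁)`. -/
def firstPointHom {N : Type*} [TopologicalSpace N] (n : Conf N) :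
    PureBraid n →* FundamentalGroup N n.1.1 :=
  FundamentalGroup.map (firstPoint N) n

/-- The 2-torus `ℝ²/ℤ²`. -/
abbrev Torus : Type := UnitAddCircle × UnitAddCircle

/-- The covering `ℝ² = ℂ → ℝ²/ℤ²`. -/
def toTorus (z : ℂ) : Torus := ((z.re : UnitAddCircle), (z.im : UnitAddCircle))

theorem continuous_toTorus : Continuous toTorus :=
  ((AddCircle.continuous_mk' (1 : ℝ)).comp Complex.continuous_re).prodMk
    ((AddCircle.continuous_mk' (1 : ℝ)).comp Complex.continuous_im)

theorem toTorus_add (z w : ℂ) : toTorus (z + w) = toTorus z + toTorus w := by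
  simp [toTorus]

theorem toTorus_zero : toTorus 0 = 0 := by
  simp [toTorus]

theorem toTorus_one : toTorus 1 = 0 := by
  have h : ((1 : ℝ) : UnitAddCircle) = 0 := AddCircle.coe_period 1
  simp [toTorus, h]

theorem toTorus_I : toTorus Complex.I = 0 := by
  have h : ((1 : ℝ) : UnitAddCircle) = 0 := AddCircle.coe_period 1
  simp [toTorus, h]

theorem toTorus_ne_zero {w : ℂ} (h0 : w ≠ 0) (h1 : ‖w‖ < 1) : toTorus w ≠ 0 := by
  have key : ∀ r : ℝ, |r| < 1 → (r : UnitAddCircle) = 0 → r = 0 := by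
    intro r hr hz
    obtain ⟨k, hk⟩ := (AddCircle.coe_eq_zero_iff (1 : ℝ)).1 hz
    have hk' : (k : ℝ) = r := by simpa using hk
    rw [← hk'] at hr ⊢
    have : |k| < 1 := by exact_mod_cast hr
    rw [Int.abs_lt_one_iff.1 this]
    simp
  intro h
  apply h0
  apply Complex.ext
  · exact key _ ((Complex.abs_re_le_norm w).trans_lt h1) (congrArg Prod.fst h)
  · exact key _ ((Complex.abs_im_le_norm w).trans_lt h1) (congrArg Prod.snd h)

/-- The translation loop `t ↦ n + t e` of the torus at `n`, for a lattice vector `e`. -/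
def latticeLoop (n : Torus) (e : ℂ) (he : toTorus e = 0) : FundamentalGroup Torus n :=
  FundamentalGroup.fromPath <| Path.Homotopic.Quotient.mk
    { toFun := fun t => n + toTorus ((t : ℝ) * e)
      continuous_toFun := continuous_const.add (continuous_toTorus.comp (by fun_prop))
      source' := by simp [toTorus_zero]
      target' := by simp [he] }

/-- The rotation factor `exp(iπt)`. -/
def rot (t : unitInterval) : ℂ := Complex.exp (((t : ℝ) * Real.pi : ℝ) * Complex.I)

theorem continuous_rot : Continuous rot := by
  unfold rot
  fun_prop

theorem norm_rot (t : unitInterval) : ‖rot t‖ = 1 := Complex.norm_exp_ofReal_mul_I _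

theorem rot_zero : rot 0 = 1 := by simp [rot]

theorem rot_one : rot 1 = -1 := by simp [rot]

/-- Let `n₂ = n₁ + v` with `‖v‖ < 1`. The path in `F₂(𝕋²)` from `(n₁, n₂)` to `(n₂, n₁)` that
rotates both points counterclockwise through the angle `π` about the midpoint `n₁ + v/2` of the
segment from `n₁` to `n₂`, inside the embedded disc that has this segment as a diameter. -/
def halfTwistPath (n₁ n₂ : Torus) (hn : n₁ ≠ n₂) (v : ℂ) (hv : ‖v‖ < 1)
    (hvn : n₂ = n₁ + toTorus v) :
    Path (⟨(n₁, n₂), hn⟩ : Conf Torus) (swap ⟨(n₁, n₂), hn⟩) where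
  toFun t := ⟨(n₁ + toTorus (v / 2 - rot t * (v / 2)), n₁ + toTorus (v / 2 + rot t * (v / 2))), by
    have hv0 : v ≠ 0 := by
      rintro rfl
      exact hn (by simp [hvn, toTorus_zero])
    have h : v / 2 + rot t * (v / 2) = (v / 2 - rot t * (v / 2)) + rot t * v := by ring
    intro he
    have he' := add_left_cancel he
    rw [h, toTorus_add, left_eq_add] at he'
    refine toTorus_ne_zero (w := rot t * v) (mul_ne_zero ?_ hv0) ?_ he'
    · exact Complex.exp_ne_zero _
    · rw [norm_mul, norm_rot, one_mul]
      exact hv⟩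
  continuous_toFun := by
    have hr := continuous_rot
    refine Continuous.subtype_mk (Continuous.prodMk ?_ ?_) _
    · exact continuous_const.add (continuous_toTorus.comp (by fun_prop))
    · exact continuous_const.add (continuous_toTorus.comp (by fun_prop))
  source' := by
    apply Subtype.ext
    simp [rot_zero, toTorus_zero, hvn]
  target' := by
    apply Subtype.ext
    simp [rot_one, toTorus_zero, hvn, swap]

/-- The standard generator `σ` of `B₂(𝕋²)` that swaps the two base points: the class of the image
of `halfTwistPath` in `D₂(𝕋²)`, which is a loop at `{n₁, n₂}`. -/
def sigma (n₁ n₂ : Torus) (hn : n₁ ≠ n₂) (v : ℂ) (hv : ‖v‖ < 1) (hvn : n₂ = n₁ + toTorus v) :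
    FullBraid (⟨(n₁, n₂), hn⟩ : Conf Torus) :=
  FundamentalGroup.fromPath <| Path.Homotopic.Quotient.mk <|
    ((halfTwistPath n₁ n₂ hn v hv hvn).map (confProj Torus).continuous).cast rfl
      (Quotient.sound (Or.inr rfl))

end TorusBraid

end

open TorusBraid

/-!
The configuration space `F₂(𝕋²)` is homeomorphic to the product of the punctured torus
`X = 𝕋² ∖ {0}` and the torus, by the difference `b - a` and the first point `a`
(`pureBraidEquiv`). So `P₂(𝕋²)` is `π₁(X) × π₁(𝕋²)`, and everything is computed in these two
factors.

*The torus.* `ℂ → 𝕋²` is a covering with simply connected total space, so a path class with given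
end points is determined by its displacement `disp`, the difference of the end points of a lift.

*The punctured torus.* At the image of `center = (1 - i) / 2`, the straight horizontal and vertical
loops `gen false` and `gen true` generate `π₁(X)` (`closure_range_gen`): a lift of a loop to the
plane is cut into pieces that lie in strips between neighbouring rows or columns of lattice
points, and each piece can be straightened. There are no relations (`freeHom_bijective`): a
covering `freeBundle` of `X` with fibre `F(x, y)` is glued from three charts so that the two loops
act on the fibre by left multiplication with `x` and `y`.

*The half twist.* Exchanging the points acts on the difference by `u ↦ -u`, and the half twist moves
the difference `v` to `-v` along a half turn about `0`. For `v = center` the half turns about `0`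
run along two sides of the unit squares around `0`, so they are words of length two in the
generators (`turn_center`, `turn_neg_center`). This gives the full twist
`x y⁻¹ x⁻¹ y` and the conjugation formulas (`turn_trans_turn`, `turn_conj_gen`). The general `v`
reduces to this one by sliding the half turn along a path in the punctured unit disc
(`exists_conj_turn`). The coefficients in `ℤ ⊕ ℤ` come from the displacement of the second point,
which is the sum of those of the first point and of the difference.

Finally, `F₂(𝕋²) → D₂(𝕋²)` is a covering (`isCoveringMap_confProj`). Hence `P₂(𝕋²) → B₂(𝕋²)` is
injective, and `σ` is not in the image, because it lifts to a path that is not closed.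
-/

noncomputable section

namespace TorusBraid

open unitInterval

/-! ### The covering of the torus by the plane -/

/-- The covering `ℂ → 𝕋²` as a homomorphism of additive groups. -/
def toTorusHom : ℂ →+ Torus where
  toFun := toTorus
  map_zero' := toTorus_zero
  map_add' := toTorus_add

theorem toTorus_neg (z : ℂ) : toTorus (-z) = -toTorus z := toTorusHom.map_neg z

theorem toTorus_sub (z w : ℂ) : toTorus (z - w) = toTorus z - toTorus w := toTorusHom.map_sub z w

theorem isOpenQuotientMap_toTorus : IsOpenQuotientMap toTorus := by
  have h : IsOpenQuotientMap ((↑) : ℝ → UnitAddCircle) :=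
    (AddCircle.isAddQuotientCoveringMap_coe (1 : ℝ)).isOpenQuotientMap
  exact (h.prodMap h).comp Complex.equivRealProdCLM.toHomeomorph.isOpenQuotientMap

theorem isCoveringMap_toTorus : IsCoveringMap toTorus := by
  have hd : IsDiscrete (toTorusHom.ker : Set ℂ) := by
    rw [isDiscrete_iff_forall_mem_exists_isOpen]
    intro z hz
    refine ⟨Metric.ball z 1, Metric.isOpen_ball, ?_⟩
    ext w
    simp only [Set.mem_inter_iff, Metric.mem_ball, Set.mem_singleton_iff]
    constructor
    · rintro ⟨hw, hw'⟩
      by_contra hne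
      refine toTorus_ne_zero (sub_ne_zero.2 hne) (by rwa [← dist_eq_norm]) ?_
      rw [toTorus_sub]
      have h1 : toTorus z = 0 := hz
      have h2 : toTorus w = 0 := hw'
      rw [h1, h2, sub_zero]
    · rintro rfl
      simpa using hz
  have := (IsOpenQuotientMap.isQuotientMap isOpenQuotientMap_toTorus
    ).isAddQuotientCoveringMap_of_isDiscrete_ker_addMonoidHom (f := toTorusHom) hd
  exact this.isCoveringMap

theorem toTorus_eq_zero_iff {z : ℂ} :
    toTorus z = 0 ↔ ∃ m n : ℤ, z = m + n * Complex.I := by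
  have key : ∀ r : ℝ, (r : UnitAddCircle) = 0 ↔ ∃ m : ℤ, r = m := fun r => by
    rw [AddCircle.coe_eq_zero_iff]
    simp [eq_comm]
  simp only [toTorus, Prod.mk_eq_zero, key]
  constructor
  · rintro ⟨⟨m, hm⟩, n, hn⟩
    exact ⟨m, n, Complex.ext (by simp [hm]) (by simp [hn])⟩
  · rintro ⟨m, n, rfl⟩
    exact ⟨⟨m, by simp⟩, n, by simp⟩

theorem exists_toTorus_lift {a b : Torus} (γ : Path a b) {z : ℂ} (hz : toTorus z = a) :
    ∃ (w : ℂ) (f : Path z w), ∀ t, toTorus (f t) = γ t := by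
  have h0 : (γ : C(I, Torus)) 0 = toTorus z := by simp [hz]
  refine ⟨_, ⟨isCoveringMap_toTorus.liftPath γ z h0,
    isCoveringMap_toTorus.liftPath_zero γ z h0, rfl⟩, fun t => ?_⟩
  exact congrFun (isCoveringMap_toTorus.liftPath_lifts γ z h0) t

/-- The displacement of a path class of the torus: the difference of the end points of any lift
of it to `ℂ`. The lift used here starts at an arbitrary point over the source; see `disp_mk` for
the independence of that choice. -/
def disp {a b : Torus} (α : Path.Homotopic.Quotient a b) : ℂ :=
  (isCoveringMap_toTorus.monodromy α ⟨_, isOpenQuotientMap_toTorus.surjective a |>.choose_spec⟩ : ℂ)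
    - (isOpenQuotientMap_toTorus.surjective a).choose

theorem disp_mk {a b : Torus} {γ : Path a b} {z w : ℂ} (f : Path z w)
    (h : ∀ t, toTorus (f t) = γ t) : disp (.mk γ) = w - z := by
  have hs := (isOpenQuotientMap_toTorus.surjective a).choose_spec
  set s := (isOpenQuotientMap_toTorus.surjective a).choose with hs_def
  have hz : toTorus z = a := by simpa using h 0
  have hw : toTorus w = b := by simpa using h 1
  have hl : toTorus (s - z) = 0 := by rw [toTorus_sub, hs, hz, sub_self]
  have hwb : toTorus (w + (s - z)) = b := by rw [toTorus_add, hl, hw, add_zero]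
  let g : Path s (w + (s - z)) :=
    ⟨⟨fun t => f t + (s - z), by fun_prop⟩, by simp, by simp⟩
  have hm := isCoveringMap_toTorus.monodromy_eq_of_map_eq (x := a) (y := b) (γ := .mk γ)
    (ex := ⟨s, hs⟩) (ey := ⟨w + (s - z), hwb⟩) (.mk g) (by
      refine congrArg Path.Homotopic.Quotient.mk (a₂ := γ.cast hs hwb)
        (Path.ext (funext fun t => ?_))
      change toTorus (f t + (s - z)) = γ t
      rw [toTorus_add, hl, h, add_zero])
  rw [disp]
  rw [hm]
  ring

theorem disp_trans {a b c : Torus} (α : Path.Homotopic.Quotient a b)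
    (β : Path.Homotopic.Quotient b c) : disp (α.trans β) = disp α + disp β := by
  induction α with | mk γ =>
  induction β with | mk δ =>
  obtain ⟨z, hz⟩ := isOpenQuotientMap_toTorus.surjective a
  obtain ⟨w, f, hf⟩ := exists_toTorus_lift γ hz
  obtain ⟨u, g, hg⟩ := exists_toTorus_lift δ (z := w) (by simpa using hf 1)
  rw [disp_mk f hf, disp_mk g hg, ← Path.Homotopic.Quotient.mk_trans, disp_mk (f.trans g)]
  · ring
  · intro t
    simp only [Path.trans_apply]
    split_ifs
    · exact hf _
    · exact hg _

theorem disp_refl (a : Torus) : disp (.refl a) = 0 := by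
  have h := disp_trans (.refl a) (.refl a)
  simpa using h

theorem disp_symm {a b : Torus} (α : Path.Homotopic.Quotient a b) : disp α.symm = -disp α := by
  have h := disp_trans α α.symm
  rw [Path.Homotopic.Quotient.trans_symm, disp_refl] at h
  linear_combination -h

/-- Displacement determines a path class with given end points, because `ℂ` is simply
connected. -/
theorem disp_injective {a b : Torus} {α β : Path.Homotopic.Quotient a b} (h : disp α = disp β) :
    α = β := by
  induction α with | mk γ =>
  induction β with | mk δ =>
  obtain ⟨z, hz⟩ := isOpenQuotientMap_toTorus.surjective a
  obtain ⟨w, f, hf⟩ := exists_toTorus_lift γ hz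
  obtain ⟨u, g, hg⟩ := exists_toTorus_lift δ hz
  rw [disp_mk f hf, disp_mk g hg, sub_left_inj] at h
  subst h
  have hw : toTorus w = b := by simpa using hf 1
  obtain ⟨H⟩ := SimplyConnectedSpace.paths_homotopic f g
  have hfγ : γ = (f.map continuous_toTorus).cast hz.symm hw.symm := by
    ext1; funext t; exact (hf t).symm
  have hgδ : δ = (g.map continuous_toTorus).cast hz.symm hw.symm := by
    ext1; funext t; exact (hg t).symm
  rw [Path.Homotopic.Quotient.eq, hfγ, hgδ]
  exact Path.Homotopic.pathCast ⟨H.map ⟨toTorus, continuous_toTorus⟩⟩ _ _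

theorem toTorus_disp {a b : Torus} (α : Path.Homotopic.Quotient a b) :
    toTorus (disp α) = b - a := by
  induction α with | mk γ =>
  obtain ⟨z, hz⟩ := isOpenQuotientMap_toTorus.surjective a
  obtain ⟨w, f, hf⟩ := exists_toTorus_lift γ hz
  have hw : toTorus w = b := by simpa using hf 1
  rw [disp_mk f hf, toTorus_sub, hz, hw]

theorem exists_int_disp {a : Torus} (g : FundamentalGroup Torus a) :
    ∃ m n : ℤ, disp g = m + n * Complex.I :=
  toTorus_eq_zero_iff.1 (by rw [toTorus_disp, sub_self])

theorem floor_re_add_mul_I (m n : ℤ) : ⌊((m : ℂ) + n * Complex.I).re⌋ = m := by simp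

theorem floor_im_add_mul_I (m n : ℤ) : ⌊((m : ℂ) + n * Complex.I).im⌋ = n := by simp

theorem disp_latticeLoop (n : Torus) (e : ℂ) (he : toTorus e = 0) :
    disp (latticeLoop n e he) = e := by
  obtain ⟨z, hz⟩ := isOpenQuotientMap_toTorus.surjective n
  let f : Path z (z + e) := ⟨⟨fun t => z + (t : ℝ) * e, by fun_prop⟩, by simp, by simp⟩
  refine (disp_mk f fun t => ?_).trans (by ring)
  change toTorus (z + (t : ℝ) * e) = n + toTorus ((t : ℝ) * e)
  rw [toTorus_add, hz]

/-- The identification `π₁(𝕋², a) ≅ ℤ ⊕ ℤ` by the coordinates of the displacement. The coordinates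
are integers, so that the floor functions serve only to read them off. -/
def torusGroupEquiv (a : Torus) :
    FundamentalGroup Torus a ≃* Multiplicative ℤ × Multiplicative ℤ :=
  MulEquiv.ofBijective
    ({ toFun := fun g => (.ofAdd ⌊(disp g).re⌋, .ofAdd ⌊(disp g).im⌋)
       map_one' := by
        change (Multiplicative.ofAdd ⌊(disp (.refl a)).re⌋,
          Multiplicative.ofAdd ⌊(disp (.refl a)).im⌋) = 1
        rw [disp_refl]
        simp
       map_mul' := fun g h => by
        obtain ⟨m, n, hg⟩ := exists_int_disp g
        obtain ⟨k, l, hh⟩ := exists_int_disp h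
        have : disp (g * h) = ((m + k : ℤ) : ℂ) + ((n + l : ℤ) : ℂ) * Complex.I := by
          rw [FundamentalGroup.mul_def, disp_trans, hg, hh]
          push_cast
          ring
        rw [this, hg, hh]
        simp only [floor_re_add_mul_I, floor_im_add_mul_I, ofAdd_add, Prod.mk_mul_mk] } :
      FundamentalGroup Torus a →* Multiplicative ℤ × Multiplicative ℤ)
    ⟨fun g h hgh => by
      obtain ⟨m, n, hg⟩ := exists_int_disp g
      obtain ⟨k, l, hh⟩ := exists_int_disp h
      simp only [MonoidHom.coe_mk, OneHom.coe_mk, hg, hh, floor_re_add_mul_I, floor_im_add_mul_I,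
        Prod.mk.injEq, EmbeddingLike.apply_eq_iff_eq] at hgh
      apply disp_injective
      rw [hg, hh, hgh.1, hgh.2],
    fun ⟨m, n⟩ => by
      refine ⟨latticeLoop a (m.toAdd + n.toAdd * Complex.I)
        (toTorus_eq_zero_iff.2 ⟨m.toAdd, n.toAdd, rfl⟩), ?_⟩
      simp only [MonoidHom.coe_mk, OneHom.coe_mk, disp_latticeLoop, floor_re_add_mul_I,
        floor_im_add_mul_I, ofAdd_toAdd]⟩

theorem torusGroupEquiv_eq_of_disp {a : Torus} {g : FundamentalGroup Torus a} {m n : ℤ}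
    (h : disp g = m + n * Complex.I) : torusGroupEquiv a g = (.ofAdd m, .ofAdd n) := by
  change (Multiplicative.ofAdd ⌊(disp g).re⌋, Multiplicative.ofAdd ⌊(disp g).im⌋) = _
  rw [h, floor_re_add_mul_I, floor_im_add_mul_I]

theorem disp_eq_of_torusGroupEquiv {a : Torus} {g : FundamentalGroup Torus a} {m n : ℤ}
    (h : torusGroupEquiv a g = (.ofAdd m, .ofAdd n)) : disp g = m + n * Complex.I := by
  obtain ⟨k, l, hg⟩ := exists_int_disp g
  rw [torusGroupEquiv_eq_of_disp hg] at h
  simp only [Prod.mk.injEq, EmbeddingLike.apply_eq_iff_eq] at h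
  rw [hg, h.1, h.2]

/-! ### Planar paths in the punctured torus -/

/-- The once punctured torus `𝕋² ∖ {0}`. -/
abbrev PuncturedTorus : Type := {u : Torus // u ≠ 0}

/-- A convex set of the plane without lattice points. It maps to the punctured torus, and any two
paths in it with the same end points become homotopic there. -/
structure IsCell (S : Set ℂ) : Prop where
  convex : Convex ℝ S
  ne_zero : ∀ z ∈ S, toTorus z ≠ 0

/-- The path of the punctured torus covered by a planar path that avoids the lattice. Its end
points `p`, `q` are free parameters, so that translates of one planar path can be compared. -/
def planarPath {z w : ℂ} (f : Path z w) (hf : ∀ t, toTorus (f t) ≠ 0) {p q : PuncturedTorus}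
    (hp : toTorus z = p) (hq : toTorus w = q) : Path p q where
  toFun t := ⟨toTorus (f t), hf t⟩
  continuous_toFun := (continuous_toTorus.comp f.continuous).subtype_mk _
  source' := Subtype.ext (by simpa using hp)
  target' := Subtype.ext (by simpa using hq)

theorem segment_mem {S : Set ℂ} (hS : Convex ℝ S) {z w : ℂ} (hz : z ∈ S) (hw : w ∈ S) (t : I) :
    Path.segment z w t ∈ S := by
  rw [Path.segment_apply]
  exact hS.lineMap_mem hz hw t.2

/-- The class of the straight path from `z` to `w` inside a cell. -/
def chord {S : Set ℂ} (hS : IsCell S) {z w : ℂ} (hz : z ∈ S) (hw : w ∈ S) {p q : PuncturedTorus}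
    (hp : toTorus z = p) (hq : toTorus w = q) : Path.Homotopic.Quotient p q :=
  .mk (planarPath (.segment z w) (fun t => hS.ne_zero _ (segment_mem hS.convex hz hw t)) hp hq)

/-- A cell is convex and avoids the lattice, so two paths that lift to it with the same end points
are homotopic in the punctured torus. -/
theorem mk_eq_mk_of_lift_mem {S : Set ℂ} (hS : IsCell S) {z w : ℂ} {p q : PuncturedTorus}
    {γ δ : Path p q} (f g : Path z w) (hf : ∀ t, f t ∈ S) (hg : ∀ t, g t ∈ S)
    (hγ : ∀ t, toTorus (f t) = γ t) (hδ : ∀ t, toTorus (g t) = δ t) :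
    Path.Homotopic.Quotient.mk γ = .mk δ := by
  have hz : z ∈ S := by simpa using hf 0
  have hw : w ∈ S := by simpa using hf 1
  have : ContractibleSpace S := hS.convex.contractibleSpace ⟨z, hz⟩
  let f' : Path (⟨z, hz⟩ : S) ⟨w, hw⟩ :=
    ⟨⟨fun t => ⟨f t, hf t⟩, f.continuous.subtype_mk _⟩, Subtype.ext f.source, Subtype.ext f.target⟩
  let g' : Path (⟨z, hz⟩ : S) ⟨w, hw⟩ :=
    ⟨⟨fun t => ⟨g t, hg t⟩, g.continuous.subtype_mk _⟩, Subtype.ext g.source, Subtype.ext g.target⟩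
  let k : C(S, PuncturedTorus) := ⟨fun z => ⟨toTorus z, hS.ne_zero z z.2⟩,
    (continuous_toTorus.comp continuous_subtype_val).subtype_mk _⟩
  have hp : p = k ⟨z, hz⟩ := Subtype.ext (by simpa [k] using (hγ 0).symm)
  have hq : q = k ⟨w, hw⟩ := Subtype.ext (by simpa [k] using (hγ 1).symm)
  have hfγ : γ = (f'.map k.continuous).cast hp hq := by
    ext1; funext t; exact Subtype.ext (hγ t).symm
  have hgδ : δ = (g'.map k.continuous).cast hp hq := by
    ext1; funext t; exact Subtype.ext (hδ t).symm
  rw [Path.Homotopic.Quotient.eq, hfγ, hgδ]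
  exact Path.Homotopic.pathCast
    (Path.Homotopic.map (SimplyConnectedSpace.paths_homotopic f' g') k) _ _

theorem mk_eq_chord {S : Set ℂ} (hS : IsCell S) {z w : ℂ} {p q : PuncturedTorus} {γ : Path p q}
    (f : Path z w) (hf : ∀ t, f t ∈ S) (hγ : ∀ t, toTorus (f t) = γ t) (hz : z ∈ S) (hw : w ∈ S)
    (hp : toTorus z = p) (hq : toTorus w = q) :
    Path.Homotopic.Quotient.mk γ = chord hS hz hw hp hq :=
  mk_eq_mk_of_lift_mem hS f _ hf (segment_mem hS.convex hz hw) hγ fun _ => rfl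

theorem toTorus_trans_apply {z w u : ℂ} {p q r : PuncturedTorus} {γ : Path p q} {δ : Path q r}
    {f : Path z w} {g : Path w u} (hγ : ∀ t, toTorus (f t) = γ t)
    (hδ : ∀ t, toTorus (g t) = δ t) (t : I) : toTorus (f.trans g t) = γ.trans δ t := by
  simp only [Path.trans_apply]
  split_ifs
  · exact hγ _
  · exact hδ _

theorem chord_trans {S : Set ℂ} (hS : IsCell S) {z w u : ℂ} (hz : z ∈ S) (hw : w ∈ S) (hu : u ∈ S)
    {p q r : PuncturedTorus} (hp : toTorus z = p) (hq : toTorus w = q) (hr : toTorus u = r) :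
    (chord hS hz hw hp hq).trans (chord hS hw hu hq hr) = chord hS hz hu hp hr := by
  unfold chord
  rw [← Path.Homotopic.Quotient.mk_trans]
  refine mk_eq_chord hS ((Path.segment z w).trans (Path.segment w u)) (fun t => ?_)
    (toTorus_trans_apply (fun _ => rfl) fun _ => rfl) hz hu hp hr
  simp only [Path.trans_apply]
  split_ifs
  · exact segment_mem hS.convex hz hw _
  · exact segment_mem hS.convex hw hu _

theorem chord_self {S : Set ℂ} (hS : IsCell S) {z : ℂ} (hz : z ∈ S) {p : PuncturedTorus}
    (hp : toTorus z = p) : chord hS hz hz hp hp = .refl p := by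
  symm
  exact mk_eq_chord hS (γ := Path.refl p) (Path.refl z) (fun _ => hz) (fun _ => hp) hz hz hp hp

theorem chord_symm {S : Set ℂ} (hS : IsCell S) {z w : ℂ} (hz : z ∈ S) (hw : w ∈ S)
    {p q : PuncturedTorus} (hp : toTorus z = p) (hq : toTorus w = q) :
    (chord hS hz hw hp hq).symm = chord hS hw hz hq hp := by
  have h := chord_trans hS hz hw hz hp hq hp
  rw [chord_self] at h
  calc _ = (chord hS hz hw hp hq).symm.trans (.refl p) := by simp
    _ = _ := by rw [← h, ← Path.Homotopic.Quotient.trans_assoc]; simp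

/-- Chords that differ by a lattice translation agree, whatever cells they are taken in. -/
theorem chord_eq_chord {S S' : Set ℂ} (hS : IsCell S) (hS' : IsCell S') {z w z' w' : ℂ}
    (hz : z ∈ S) (hw : w ∈ S) (hz' : z' ∈ S') (hw' : w' ∈ S') {p q : PuncturedTorus}
    (hp : toTorus z = p) (hq : toTorus w = q) (hp' : toTorus z' = p) (hq' : toTorus w' = q)
    (h : w - z = w' - z') : chord hS hz hw hp hq = chord hS' hz' hw' hp' hq' := by
  unfold chord
  congr 1
  ext1
  funext t
  apply Subtype.ext
  change toTorus (Path.segment z w t) = toTorus (Path.segment z' w' t)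
  have e : Path.segment z w t = Path.segment z' w' t + (z - z') := by
    simp only [Path.segment_apply, AffineMap.lineMap_apply, vsub_eq_sub, h, vadd_eq_add]
    ring
  rw [e, toTorus_add, toTorus_sub, hp, hp', sub_self, add_zero]

/-! ### Generators of the fundamental group of the punctured torus -/

/-- The coordinate of the plane that is bounded on the strips of type `b`. -/
def coord : Bool → ℂ →ₗ[ℝ] ℝ
  | true => Complex.reLm
  | false => Complex.imLm

/-- The lattice direction of the strips of type `b`. -/
def dir : Bool → ℂ
  | true => Complex.I
  | false => 1

/-- The open strips between neighbouring vertical (`b = true`) or horizontal (`b = false`) lines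
through lattice points. -/
def strip (b : Bool) (n : ℤ) : Set ℂ := {z | (n : ℝ) < coord b z ∧ coord b z < n + 1}

theorem coord_dir (b : Bool) : coord b (dir b) = 0 := by cases b <;> simp [coord, dir]

theorem coord_not_dir (b : Bool) : coord (!b) (dir b) = 1 := by cases b <;> simp [coord, dir]

theorem toTorus_int_mul_dir (b : Bool) (k : ℤ) : toTorus (k * dir b) = 0 := by
  rw [toTorus_eq_zero_iff]
  cases b
  · exact ⟨k, 0, by simp [dir]⟩
  · exact ⟨0, k, by simp [dir]⟩

theorem toTorus_dir (b : Bool) : toTorus (dir b) = 0 := by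
  simpa using toTorus_int_mul_dir b 1

theorem coord_int_of_toTorus_eq_zero {z : ℂ} (hz : toTorus z = 0) :
    ∃ k : Bool → ℤ, (∀ b, coord b z = k b) ∧ ∀ b, z = k b * dir (!b) + k (!b) * dir b := by
  obtain ⟨m, n, rfl⟩ := toTorus_eq_zero_iff.1 hz
  refine ⟨fun b => cond b m n, ?_, ?_⟩ <;> intro b <;> cases b <;> simp [coord, dir]
  ring

theorem isCell_strip (b : Bool) (n : ℤ) : IsCell (strip b n) where
  convex := by
    have : strip b n = coord b ⁻¹' Set.Ioo (n : ℝ) (n + 1) := rfl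
    rw [this]
    exact (convex_Ioo _ _).linear_preimage _
  ne_zero z hz h := by
    obtain ⟨k, hk, -⟩ := coord_int_of_toTorus_eq_zero h
    rw [strip, Set.mem_ofPred_eq, hk] at hz
    have h1 : n < k b := by exact_mod_cast hz.1
    have h2 : k b < n + 1 := by exact_mod_cast hz.2
    omega

theorem isOpen_strip (b : Bool) (n : ℤ) : IsOpen (strip b n) :=
  isOpen_Ioo.preimage (LinearMap.continuous_of_finiteDimensional (coord b))

theorem exists_mem_strip {z : ℂ} (hz : toTorus z ≠ 0) : ∃ b n, z ∈ strip b n := by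
  by_contra! h
  apply hz
  have key : ∀ b, coord b z = ⌊coord b z⌋ := fun b => by
    by_contra hne
    exact h b ⌊coord b z⌋ ⟨lt_of_le_of_ne (Int.floor_le _) (Ne.symm hne), Int.lt_floor_add_one _⟩
  exact toTorus_eq_zero_iff.2 ⟨⌊coord true z⌋, ⌊coord false z⌋,
    Complex.ext (by simpa [coord] using key true) (by simpa [coord] using key false)⟩

theorem eq_of_mem_strip {b : Bool} {m n : ℤ} {z : ℂ} (hm : z ∈ strip b m) (hn : z ∈ strip b n) :
    m = n := by
  have h1 : (m : ℝ) < n + 1 := hm.1.trans hn.2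
  have h2 : (n : ℝ) < m + 1 := hn.1.trans hm.2
  have h1' : m < n + 1 := by exact_mod_cast h1
  have h2' : n < m + 1 := by exact_mod_cast h2
  omega

theorem add_int_mul_dir_mem_strip {b : Bool} {n : ℤ} {z : ℂ} (hz : z ∈ strip b n) (k : ℤ) :
    z + k * dir b ∈ strip b n := by
  have : coord b (z + k * dir b) = coord b z := by
    have h : (k : ℂ) * dir b = k • dir b := by simp
    rw [map_add, h, map_zsmul, coord_dir, smul_zero, add_zero]
  simpa only [strip, Set.mem_ofPred_eq, this] using hz

/-- The base point of the plane, the centre of the unit square to the lower right of `0`. With this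
choice the two halves of a full turn about `0` are the words `x⁻¹ * y` and `x * y⁻¹` in the
generators (`turn_center`, `turn_neg_center`), so that the full turn is the commutator
`x * y⁻¹ * x⁻¹ * y`. -/
def center : ℂ := (1 - Complex.I) / 2

theorem coord_center (b : Bool) : coord b center = cond b (1 / 2) (-1 / 2) := by
  cases b <;> simp [coord, center]

/-- The index of the strip of type `b` through `center`. -/
def centerStrip (b : Bool) : ℤ := cond b 0 (-1)

theorem center_mem_strip (b : Bool) : center ∈ strip b (centerStrip b) := by
  rw [strip, Set.mem_ofPred_eq, coord_center]
  cases b <;> norm_num [centerStrip]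

/-- The image of `center`. -/
def basePoint : PuncturedTorus :=
  ⟨toTorus center, (isCell_strip true _).ne_zero _ (center_mem_strip true)⟩

theorem toTorus_center_add {l : ℂ} (hl : toTorus l = 0) : toTorus (center + l) = basePoint := by
  rw [toTorus_add, hl, add_zero]
  rfl

theorem toTorus_add_int_mul_dir {z : ℂ} {p : PuncturedTorus} (hz : toTorus z = p) (b : Bool)
    (k : ℤ) : toTorus (z + k * dir b) = p := by
  rw [toTorus_add, toTorus_int_mul_dir, add_zero, hz]

theorem center_add_dir_mem_strip (b : Bool) : center + dir b ∈ strip b (centerStrip b) := by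
  simpa using add_int_mul_dir_mem_strip (center_mem_strip b) 1

/-- The straight loop at `basePoint` in the direction `dir b`: for `b = false` the horizontal loop
`x`, for `b = true` the vertical loop `y`. -/
def gen (b : Bool) : FundamentalGroup PuncturedTorus basePoint :=
  chord (isCell_strip b _) (center_mem_strip b) (center_add_dir_mem_strip b) (p := basePoint)
    (q := basePoint) rfl (toTorus_center_add (toTorus_dir b))

theorem chord_dir_eq_gen {S : Set ℂ} (hS : IsCell S) {b : Bool} {z w : ℂ} (hz : z ∈ S)
    (hw : w ∈ S) (hp : toTorus z = basePoint) (hq : toTorus w = basePoint) (h : w - z = dir b) :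
    chord hS hz hw hp hq = gen b :=
  chord_eq_chord _ _ _ _ _ _ _ _ _ _ (by rw [h]; ring)

theorem chord_neg_dir_eq_gen_inv {S : Set ℂ} (hS : IsCell S) {b : Bool} {z w : ℂ} (hz : z ∈ S)
    (hw : w ∈ S) (hp : toTorus z = basePoint) (hq : toTorus w = basePoint) (h : z - w = dir b) :
    chord hS hz hw hp hq = (gen b)⁻¹ := by
  rw [← chord_dir_eq_gen hS hw hz hq hp h]
  exact (chord_symm hS hw hz hq hp).symm

theorem chord_int_mul_dir_mem {b : Bool} {n : ℤ} {z : ℂ} (hz : z ∈ strip b n)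
    (hp : toTorus z = basePoint) (k : ℤ) :
    chord (isCell_strip b n) hz (add_int_mul_dir_mem_strip hz k) hp
      (toTorus_add_int_mul_dir hp b k) ∈ Subgroup.closure (Set.range gen) := by
  have hgen : gen b ∈ Subgroup.closure (Set.range gen) := Subgroup.subset_closure ⟨b, rfl⟩
  induction k with
  | zero =>
    have : chord (isCell_strip b n) hz (add_int_mul_dir_mem_strip hz 0) hp
        (toTorus_add_int_mul_dir hp b 0) = .refl basePoint := by
      rw [← chord_self (isCell_strip b n) hz hp]
      exact chord_eq_chord _ _ _ _ _ _ _ _ _ _ (by simp)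
    rw [this]
    exact one_mem _
  | succ k ih =>
    rw [← chord_trans (isCell_strip b n) hz (add_int_mul_dir_mem_strip hz k)
      (add_int_mul_dir_mem_strip hz (k + 1)) hp (toTorus_add_int_mul_dir hp b k),
      chord_dir_eq_gen (b := b) (isCell_strip b n) (add_int_mul_dir_mem_strip hz k)
        (add_int_mul_dir_mem_strip hz (k + 1)) _ _ (by push_cast; ring)]
    exact Subgroup.mul_mem (G := FundamentalGroup PuncturedTorus basePoint) _ hgen ih
  | pred k ih =>
    rw [← chord_trans (isCell_strip b n) hz (add_int_mul_dir_mem_strip hz (-k))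
      (add_int_mul_dir_mem_strip hz (-k - 1)) hp (toTorus_add_int_mul_dir hp b (-k)),
      chord_neg_dir_eq_gen_inv (b := b) (isCell_strip b n) (add_int_mul_dir_mem_strip hz (-k))
        (add_int_mul_dir_mem_strip hz (-k - 1)) _ _ (by push_cast; ring)]
    exact Subgroup.mul_mem (G := FundamentalGroup PuncturedTorus basePoint) _ (inv_mem hgen) ih

/-- The normal form of path classes used to show that the loops `gen` generate: an element of the
group generated by them, followed by a chord inside a strip from a translate of `center` to the
point `z` of the plane. -/
def IsStandard {p : PuncturedTorus} (α : Path.Homotopic.Quotient basePoint p) (z : ℂ) : Prop :=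
  ∃ h ∈ Subgroup.closure (Set.range gen), ∃ (b : Bool) (n : ℤ) (l : ℂ) (hl : toTorus l = 0)
    (hc : center + l ∈ strip b n) (hz : z ∈ strip b n) (hp : toTorus z = p),
    α = Path.Homotopic.Quotient.trans h
      (chord (isCell_strip b n) hc hz (toTorus_center_add hl) hp)

/-- Standard form is preserved by chords inside strips: when the chord leaves the strip of the
standard form, the two strips are perpendicular, and one passes through the centre of the square
in which they meet. -/
theorem IsStandard.trans_chord {p q : PuncturedTorus} {α : Path.Homotopic.Quotient basePoint p}
    {z w : ℂ} (h : IsStandard α z) {b : Bool} {n : ℤ} (hz : z ∈ strip b n) (hw : w ∈ strip b n)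
    (hp : toTorus z = p) (hq : toTorus w = q) :
    IsStandard (α.trans (chord (isCell_strip b n) hz hw hp hq)) w := by
  obtain ⟨g, hg, b', n', l, hl, hc, hz', hp', rfl⟩ := h
  by_cases hb : b' = b
  · subst hb
    obtain rfl := eq_of_mem_strip hz hz'
    refine ⟨g, hg, b', n, l, hl, hc, hw, hq, ?_⟩
    rw [Path.Homotopic.Quotient.trans_assoc, chord_trans]
  · obtain rfl : b = !b' := by cases b <;> cases b' <;> simp_all
    obtain ⟨c, hc1, -⟩ := coord_int_of_toTorus_eq_zero hl
    -- `k` steps along the strip `b'` lead from the given centre to the one in the strip `!b'`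
    set k : ℤ := n - c (!b') - centerStrip (!b')
    have hk : toTorus (l + k * dir b') = 0 := by
      rw [toTorus_add, hl, toTorus_int_mul_dir, add_zero]
    have hcz : center + (l + k * dir b') ∈ strip (!b') n := by
      have hm := center_mem_strip (!b')
      have hh : (k : ℂ) * dir b' = k • dir b' := by simp
      have e : coord (!b') (center + (l + k * dir b'))
          = coord (!b') center + (n - centerStrip (!b')) := by
        rw [map_add, map_add, hc1, hh, map_zsmul, coord_not_dir]
        simp only [k, zsmul_eq_mul, mul_one]
        push_cast
        ring
      rw [strip, Set.mem_ofPred_eq] at hm ⊢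
      rw [e]
      constructor <;> linarith [hm.1, hm.2]
    have hcz' : center + (l + k * dir b') ∈ strip b' n' := by
      rw [← add_assoc]
      exact add_int_mul_dir_mem_strip hc k
    refine ⟨_, Subgroup.mul_mem _ (chord_int_mul_dir_mem hc (toTorus_center_add hl) k) hg, !b',
      n, _, hk, hcz, hw, hq, ?_⟩
    rw [FundamentalGroup.mul_def, Path.Homotopic.Quotient.trans_assoc,
      Path.Homotopic.Quotient.trans_assoc]
    congr 1
    rw [← chord_trans (isCell_strip b' n') hc hcz' hz' _ (toTorus_center_add hk),
      ← chord_trans (isCell_strip (!b') n) hcz hz hw _ hp, Path.Homotopic.Quotient.trans_assoc]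
    congr 1
    · exact chord_eq_chord _ _ _ _ _ _ _ _ _ _ (by ring)

theorem IsStandard.mem_closure {p : PuncturedTorus} {α : Path.Homotopic.Quotient basePoint p}
    {z : ℂ} (h : IsStandard α z) (hp : basePoint = p) :
    (α.cast rfl hp : FundamentalGroup PuncturedTorus basePoint) ∈
      Subgroup.closure (Set.range gen) := by
  subst hp
  obtain ⟨g, hg, b, n, l, hl, hc, hz, hp, rfl⟩ := h
  have hd : toTorus (z - (center + l)) = 0 := by
    rw [toTorus_sub, hp, toTorus_center_add hl, sub_self]
  obtain ⟨c, hc1, hc2⟩ := coord_int_of_toTorus_eq_zero hd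
  have h0 : c b = 0 := by
    have h1 := hc1 b
    rw [map_sub] at h1
    have h2 : (c b : ℝ) < 1 := by linarith [hz.2, hc.1]
    have h3 : (-1 : ℝ) < c b := by linarith [hz.1, hc.2]
    have h2' : c b < 1 := by exact_mod_cast h2
    have h3' : -1 < c b := by exact_mod_cast h3
    omega
  obtain rfl : z = center + l + c (!b) * dir b := by
    have := hc2 b
    rw [h0] at this
    linear_combination this
  rw [Path.Homotopic.Quotient.cast_rfl_rfl]
  exact Subgroup.mul_mem (G := FundamentalGroup PuncturedTorus basePoint) _
    (chord_int_mul_dir_mem hc (toTorus_center_add hl) (c (!b))) hg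

/-- The horizontal and the vertical loop generate the fundamental group of the punctured torus. -/
theorem closure_range_gen : Subgroup.closure (Set.range gen) = ⊤ := by
  rw [eq_top_iff]
  rintro g -
  induction g using Path.Homotopic.Quotient.ind with | mk γ =>
  obtain ⟨w, f, hf⟩ := exists_toTorus_lift (γ.map continuous_subtype_val) (z := center) rfl
  replace hf : ∀ t, toTorus (f t) = γ t := hf
  have hcov : (Set.univ : Set I) ⊆ ⋃ i : Bool × ℤ, f ⁻¹' strip i.1 i.2 := fun t _ => by
    obtain ⟨b, n, h⟩ := exists_mem_strip (z := f t) (by rw [hf]; exact (γ t).2)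
    exact Set.mem_iUnion.2 ⟨(b, n), h⟩
  obtain ⟨t, t0, tm, ⟨N, hN⟩, ht⟩ := exists_monotone_Icc_subset_open_cover_unitInterval
    (fun i : Bool × ℤ => (isOpen_strip i.1 i.2).preimage f.continuous) hcov
  have key : ∀ n, IsStandard (.mk ((γ.subpath 0 (t n)).cast γ.source.symm rfl)) (f (t n)) := by
    intro n
    induction n with
    | zero =>
      rw [t0]
      have hz0 : f 0 ∈ strip true (centerStrip true) := by
        rw [f.source]; exact center_mem_strip true
      refine ⟨1, one_mem _, true, centerStrip true, 0, toTorus_zero,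
        by simpa using center_mem_strip true, hz0, hf 0, ?_⟩
      rw [FundamentalGroup.one_def, Path.Homotopic.Quotient.refl_trans]
      refine mk_eq_chord _ ((Path.refl center).cast (by simp) (by simp))
        (fun _ => center_mem_strip true) (fun s => ?_) _ _ _ _
      change toTorus center = γ (Set.Icc.convexComb 0 0 s)
      simpa using hf 0
    | succ n ih =>
      obtain ⟨⟨b, k⟩, hbk⟩ := ht n
      have hle := tm (Nat.le_succ n)
      have := ih.trans_chord (hbk (Set.left_mem_Icc.2 hle)) (hbk (Set.right_mem_Icc.2 hle))
        (hf _) (hf _)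
      convert this using 1
      rw [← mk_eq_chord (isCell_strip b k) (f.subpath (t n) (t (n + 1))) (fun s => hbk ?_)
        (γ := γ.subpath (t n) (t (n + 1))) (fun s => hf _)]
      · rw [← Path.Homotopic.Quotient.mk_trans, Path.Homotopic.Quotient.eq]
        exact ⟨(Path.Homotopy.subpathTransSubpath γ 0 (t n) (t (n + 1))).symm⟩
      · exact Set.uIcc_of_le hle ▸ Path.range_subpathAux (t n) (t (n + 1)) ▸ Set.mem_range_self s
  have h1 := key N
  rw [hN N le_rfl] at h1
  have h2 := h1.mem_closure γ.target.symm
  rw [← Path.Homotopic.Quotient.mk_cast, Path.subpath_zero_one] at h2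
  exact h2

/-! ### A covering of the punctured torus with group `F(x, y)` -/

theorem coe_circle_ne_zero {r : ℝ} (h0 : 0 < r) (h1 : r < 1) : (r : UnitAddCircle) ≠ 0 := by
  intro h
  obtain ⟨k, hk⟩ := (AddCircle.coe_eq_zero_iff (1 : ℝ)).1 h
  have hk' : (k : ℝ) = r := by simpa using hk
  rw [← hk'] at h0 h1
  have h0' : 0 < k := by exact_mod_cast h0
  have h1' : k < 1 := by exact_mod_cast h1
  omega

/-- The image of `(0, 1/2)` in the circle. -/
def lowerHalf : Set UnitAddCircle := (fun r : ℝ => (r : UnitAddCircle)) '' Set.Ioo 0 (1 / 2)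

/-- The image of `(1/2, 1)` in the circle. -/
def upperHalf : Set UnitAddCircle := (fun r : ℝ => (r : UnitAddCircle)) '' Set.Ioo (1 / 2) 1

theorem isOpenMap_coe_circle : IsOpenMap fun r : ℝ => (r : UnitAddCircle) :=
  (AddCircle.isAddQuotientCoveringMap_coe (1 : ℝ)).isOpenQuotientMap.isOpenMap

theorem isOpen_lowerHalf : IsOpen lowerHalf := isOpenMap_coe_circle _ isOpen_Ioo

theorem isOpen_upperHalf : IsOpen upperHalf := isOpenMap_coe_circle _ isOpen_Ioo

theorem disjoint_halves : Disjoint lowerHalf upperHalf := by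
  rw [Set.disjoint_left]
  rintro _ ⟨r, hr, rfl⟩ ⟨s, hs, h⟩
  refine coe_circle_ne_zero (r := s - r) (by linarith [hr.2, hs.1]) (by linarith [hr.1, hs.2]) ?_
  simp only at h
  rw [AddCircle.coe_sub, h, sub_self]

theorem mem_halves {θ : UnitAddCircle} (h0 : θ ≠ 0) (h1 : θ ≠ ((1 / 2 : ℝ) : UnitAddCircle)) :
    θ ∈ lowerHalf ∨ θ ∈ upperHalf := by
  obtain ⟨r, hr, rfl⟩ : ∃ r ∈ Set.Ico (0 : ℝ) (0 + 1), (r : UnitAddCircle) = θ := by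
    have := AddCircle.coe_image_Ico_eq (1 : ℝ) 0
    have hθ : θ ∈ (Set.univ : Set UnitAddCircle) := trivial
    rw [← this] at hθ
    exact hθ
  have hr0 : r ≠ 0 := by rintro rfl; exact h0 rfl
  have hr1 : r ≠ 1 / 2 := by rintro rfl; exact h1 rfl
  have hpos : 0 < r := lt_of_le_of_ne hr.1 (Ne.symm hr0)
  rcases lt_or_gt_of_ne hr1 with h | h
  · exact Or.inl ⟨r, ⟨hpos, h⟩, rfl⟩
  · exact Or.inr ⟨r, ⟨h, by linarith [hr.2]⟩, rfl⟩

/-- The coordinate of the torus that runs along the direction `dir b`. -/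
def circleCoord : Bool → PuncturedTorus → UnitAddCircle
  | true => fun p => p.1.2
  | false => fun p => p.1.1

theorem continuous_circleCoord (b : Bool) : Continuous (circleCoord b) := by
  cases b
  · exact continuous_fst.comp continuous_subtype_val
  · exact continuous_snd.comp continuous_subtype_val

theorem circleCoord_ne_zero (p : PuncturedTorus) (b : Bool) :
    circleCoord b p ≠ 0 ∨ circleCoord (!b) p ≠ 0 := by
  by_contra! h
  apply p.2
  cases b
  · exact Prod.ext h.1 h.2
  · exact Prod.ext h.2 h.1

/-- The chart domains of the covering: `none` stands for the open unit square, and `some b` for a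
neighbourhood of the open arc in which the coordinate along `dir b` vanishes. -/
def chartSet : Option Bool → Set PuncturedTorus
  | none => {p | ∀ b, circleCoord b p ≠ 0}
  | some b => {p | circleCoord b p ≠ ((1 / 2 : ℝ) : UnitAddCircle) ∧ circleCoord (!b) p ≠ 0}

theorem isOpen_chartSet : ∀ i, IsOpen (chartSet i)
  | none => by
    have : chartSet none = ⋂ b, circleCoord b ⁻¹' {0}ᶜ := by ext; simp [chartSet]
    rw [this]
    exact isOpen_iInter_of_finite fun b =>
      isOpen_compl_singleton.preimage (continuous_circleCoord b)
  | some b => (isOpen_compl_singleton.preimage (continuous_circleCoord b)).inter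
      (isOpen_compl_singleton.preimage (continuous_circleCoord !b))

theorem exists_mem_chartSet (p : PuncturedTorus) : ∃ i, p ∈ chartSet i := by
  by_cases h : ∀ b, circleCoord b p ≠ 0
  · exact ⟨none, h⟩
  · push Not at h
    obtain ⟨b, hb⟩ := h
    refine ⟨some b, ?_, (circleCoord_ne_zero p b).resolve_left fun h => h hb⟩
    rw [hb]
    exact (coe_circle_ne_zero (by norm_num) (by norm_num)).symm

theorem chartSet_inter_subset {i j : Option Bool} (h : i ≠ j) :
    chartSet i ∩ chartSet j ⊆ chartSet none := by
  rintro p ⟨hi, hj⟩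
  match i, j with
  | none, _ => exact hi
  | some _, none => exact hj
  | some true, some true => exact absurd rfl h
  | some false, some false => exact absurd rfl h
  | some true, some false => rintro (_ | _); exacts [hi.2, hj.2]
  | some false, some true => rintro (_ | _); exacts [hj.2, hi.2]

open Classical in
/-- The transition factors of the covering. Crossing the arc in which the coordinate along `dir b`
vanishes in the positive direction, one passes from `(of b)⁻¹` to `1`. -/
def chartFactor : Option Bool → PuncturedTorus → FreeGroup Bool
  | none => fun _ => 1
  | some b => fun p => if circleCoord b p ∈ lowerHalf then 1 else (FreeGroup.of b)⁻¹

instance : TopologicalSpace (FreeGroup Bool) := ⊥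

instance : DiscreteTopology (FreeGroup Bool) := ⟨rfl⟩

theorem continuousOn_chartFactor (i : Option Bool) :
    ContinuousOn (chartFactor i) (chartSet i ∩ chartSet none) := by
  match i with
  | none => exact continuousOn_const
  | some b =>
    rintro p ⟨⟨h1, -⟩, h0⟩
    apply ContinuousAt.continuousWithinAt
    rcases mem_halves (h0 b) h1 with h | h
    · refine (continuousAt_const (y := (1 : FreeGroup Bool))).congr ?_
      filter_upwards [(isOpen_lowerHalf.preimage (continuous_circleCoord b)).mem_nhds h] with q hq
      exact (if_pos hq).symm
    · refine (continuousAt_const (y := (FreeGroup.of b)⁻¹)).congr ?_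
      filter_upwards [(isOpen_upperHalf.preimage (continuous_circleCoord b)).mem_nhds h] with q hq
      exact (if_neg fun hl => Set.disjoint_left.1 disjoint_halves hl hq).symm

/-- The principal bundle with discrete fibre `F(x, y)` over the punctured torus. -/
def freeBundle : FiberBundleCore (Option Bool) PuncturedTorus (FreeGroup Bool) where
  baseSet := chartSet
  isOpen_baseSet := isOpen_chartSet
  indexAt p := (exists_mem_chartSet p).choose
  mem_baseSet_at p := (exists_mem_chartSet p).choose_spec
  coordChange i j p f := (chartFactor j p)⁻¹ * (chartFactor i p * f)
  coordChange_self i p _ f := by simp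
  continuousOn_coordChange i j := by
    by_cases h : i = j
    · subst h
      simpa using continuousOn_snd
    · have hs : ∀ q ∈ (chartSet i ∩ chartSet j) ×ˢ (Set.univ : Set (FreeGroup Bool)),
          q.1 ∈ chartSet none := fun q hq => chartSet_inter_subset h hq.1
      have hi : ContinuousOn (fun q : PuncturedTorus × FreeGroup Bool => chartFactor i q.1)
          ((chartSet i ∩ chartSet j) ×ˢ Set.univ) :=
        (continuousOn_chartFactor i).comp continuousOn_fst fun q hq => ⟨hq.1.1, hs q hq⟩
      have hj : ContinuousOn (fun q : PuncturedTorus × FreeGroup Bool => chartFactor j q.1)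
          ((chartSet i ∩ chartSet j) ×ˢ Set.univ) :=
        (continuousOn_chartFactor j).comp continuousOn_fst fun q hq => ⟨hq.1.2, hs q hq⟩
      have hm : Continuous fun q : FreeGroup Bool × FreeGroup Bool × FreeGroup Bool =>
          q.1⁻¹ * (q.2.1 * q.2.2) := continuous_of_discreteTopology
      exact hm.comp_continuousOn (hj.prodMk (hi.prodMk continuousOn_snd))
  coordChange_comp i j k p _ f := by group

/-- The covering of the punctured torus with group `F(x, y)`. -/
theorem isCoveringMap_freeBundle : IsCoveringMap freeBundle.proj :=
  FiberBundle.isCoveringMap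

/-- The point over `p` with coordinate `(chartFactor i p)⁻¹ * u` in every chart `i` around `p`. -/
def bundlePoint (p : PuncturedTorus) (u : FreeGroup Bool) : freeBundle.proj ⁻¹' {p} :=
  ⟨⟨p, ((chartFactor (freeBundle.indexAt p) p)⁻¹ * u : FreeGroup Bool)⟩, rfl⟩

theorem bundlePoint_injective (p : PuncturedTorus) : Function.Injective (bundlePoint p) := by
  intro u w h
  have h' := congrArg (fun e : freeBundle.proj ⁻¹' {p} => e.1) h
  exact mul_left_cancel
    (Bundle.TotalSpace.mk_inj (E := freeBundle.Fiber) (F := FreeGroup Bool).1 h')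

/-- Along a path inside one chart the coordinate in that chart is constant, so the monodromy changes
the coordinate of `bundlePoint` only by the chart factors at the two ends. -/
theorem monodromy_of_mem_chartSet {p q : PuncturedTorus} {γ : Path p q} {i : Option Bool}
    (h : ∀ t, γ t ∈ chartSet i) (u : FreeGroup Bool) :
    isCoveringMap_freeBundle.monodromy (.mk γ) (bundlePoint p u) =
      bundlePoint q (chartFactor i q * (chartFactor i p)⁻¹ * u) := by
  have hc : Continuous fun t => (freeBundle.localTriv i).toOpenPartialHomeomorph.symm
      (γ t, (chartFactor i p)⁻¹ * u) := by
    refine (freeBundle.localTriv i).toOpenPartialHomeomorph.continuousOn_symm.comp_continuous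
      (by fun_prop) fun t => ?_
    exact (freeBundle.localTriv i).mem_target.2 (h t)
  let Γ : Path (bundlePoint p u).1
      (bundlePoint q (chartFactor i q * (chartFactor i p)⁻¹ * u)).1 :=
    ⟨⟨_, hc⟩, by
      change (freeBundle.localTriv i).toOpenPartialHomeomorph.symm (γ 0, _) = _
      rw [γ.source]
      change (⟨p, _⟩ : freeBundle.TotalSpace) = ⟨p, _⟩
      congr 1
      change _ * (_ * (_ * u)) = _
      group, by
      change (freeBundle.localTriv i).toOpenPartialHomeomorph.symm (γ 1, _) = _
      rw [γ.target]
      change (⟨q, _⟩ : freeBundle.TotalSpace) = ⟨q, _⟩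
      congr 1
      change _ * (_ * (_ * u)) = _ * (_ * _ * u)
      group⟩
  refine isCoveringMap_freeBundle.monodromy_eq_of_map_eq (.mk Γ) ?_
  refine congrArg Path.Homotopic.Quotient.mk (a₂ := γ.cast rfl rfl) (Path.ext (funext fun t => ?_))
  rfl

theorem circleCoord_center_add (b : Bool) {s : ℝ} {p : PuncturedTorus}
    (h : toTorus (center + s * dir b) = p) :
    circleCoord b p = ((1 / 2 + s : ℝ) : UnitAddCircle) ∧
      circleCoord (!b) p = ((1 / 2 : ℝ) : UnitAddCircle) := by
  have hm : ((-1 / 2 : ℝ) : UnitAddCircle) = ((1 / 2 : ℝ) : UnitAddCircle) := by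
    rw [show (1 / 2 : ℝ) = -1 / 2 + 1 by norm_num, AddCircle.coe_add_period]
  cases b
  · have h1 : (center + s * dir false).re = 1 / 2 + s := by simp [center, dir]
    have h2 : (center + s * dir false).im = -1 / 2 := by simp [center, dir]
    simp only [circleCoord, ← h, toTorus, Bool.not_false, h1, h2, hm, and_self]
  · have h1 : (center + s * dir true).re = 1 / 2 := by simp [center, dir]
    have h2 : (center + s * dir true).im = -1 / 2 + s := by simp [center, dir]
    simp only [circleCoord, ← h, toTorus, Bool.not_true, h1, h2, AddCircle.coe_add, hm, and_self]

/-- The points `center + s • dir b` over which the loop `gen b` runs. -/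
theorem center_add_real_mul_dir_mem (b : Bool) (s : ℝ) :
    center + s * dir b ∈ strip b (centerStrip b) := by
  have : coord b (center + s * dir b) = coord b center := by
    have h : (s : ℂ) * dir b = s • dir b := by simp
    rw [map_add, h, map_smul, coord_dir, smul_zero, add_zero]
  have hm := center_mem_strip b
  simpa only [strip, Set.mem_ofPred_eq, this] using hm

/-- The part of the loop `gen b` between the times `s` and `t`. -/
def genPart (b : Bool) (s t : ℝ) {p q : PuncturedTorus} (hp : toTorus (center + s * dir b) = p)
    (hq : toTorus (center + t * dir b) = q) : Path.Homotopic.Quotient p q :=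
  chord (isCell_strip b _) (center_add_real_mul_dir_mem b s) (center_add_real_mul_dir_mem b t)
    hp hq

theorem monodromy_genPart {b : Bool} {s t : ℝ} (hst : s ≤ t) {p q : PuncturedTorus}
    (hp : toTorus (center + s * dir b) = p) (hq : toTorus (center + t * dir b) = q)
    {i : Option Bool}
    (h : ∀ r ∈ Set.Icc s t, ∀ p' : PuncturedTorus, toTorus (center + r * dir b) = p' →
      p' ∈ chartSet i) (u : FreeGroup Bool) :
    isCoveringMap_freeBundle.monodromy (genPart b s t hp hq) (bundlePoint p u) =
      bundlePoint q (chartFactor i q * (chartFactor i p)⁻¹ * u) := by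
  refine monodromy_of_mem_chartSet (fun r => ?_) u
  refine h (AffineMap.lineMap s t (r : ℝ)) ((convex_Icc s t).lineMap_mem
    (Set.left_mem_Icc.2 hst) (Set.right_mem_Icc.2 hst) r.2) _ ?_
  change toTorus _ = toTorus (Path.segment _ _ r)
  congr 1
  simp only [Path.segment_apply, AffineMap.lineMap_apply, vsub_eq_sub, vadd_eq_add, smul_eq_mul,
    Complex.real_smul]
  push_cast
  ring

theorem mem_chartSet_none_of_center_add {b : Bool} {r : ℝ} {p : PuncturedTorus}
    (h : toTorus (center + r * dir b) = p) (hr : ((1 / 2 + r : ℝ) : UnitAddCircle) ≠ 0) :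
    p ∈ chartSet none := by
  obtain ⟨h1, h2⟩ := circleCoord_center_add b h
  have h3 : circleCoord b p ≠ 0 := by rwa [h1]
  have h4 : circleCoord (!b) p ≠ 0 := by
    rw [h2]
    exact coe_circle_ne_zero (by norm_num) (by norm_num)
  intro b'
  by_cases hb : b' = b
  · rwa [hb]
  · obtain rfl : b' = !b := by cases b <;> cases b' <;> simp_all
    exact h4

theorem mem_chartSet_some_of_center_add {b : Bool} {r : ℝ} {p : PuncturedTorus}
    (h : toTorus (center + r * dir b) = p) (h0 : 0 < r) (h1 : r < 1) : p ∈ chartSet (some b) := by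
  obtain ⟨hb, hb'⟩ := circleCoord_center_add b h
  refine ⟨?_, ?_⟩
  · rw [hb, AddCircle.coe_add]
    exact fun h => coe_circle_ne_zero h0 h1 (left_eq_add.1 h.symm)
  · rw [hb']
    exact coe_circle_ne_zero (by norm_num) (by norm_num)

/-- The loop `gen b` acts on the fibre by left multiplication with the generator `of b`: it crosses
the arc of the chart `some b` once, half way. -/
theorem monodromy_gen (b : Bool) (u : FreeGroup Bool) :
    isCoveringMap_freeBundle.monodromy (gen b) (bundlePoint basePoint u) =
      bundlePoint basePoint (FreeGroup.of b * u) := by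
  have hne : ∀ s : ℝ, toTorus (center + s * dir b) ≠ 0 := fun s =>
    (isCell_strip b _).ne_zero _ (center_add_real_mul_dir_mem b s)
  have h0 : toTorus (center + (0 : ℝ) * dir b) = basePoint :=
    toTorus_center_add (by simp [toTorus_zero])
  have h1 : toTorus (center + (1 : ℝ) * dir b) = basePoint :=
    toTorus_center_add (by simp [toTorus_dir])
  let p : PuncturedTorus := ⟨_, hne (1 / 4)⟩
  let q : PuncturedTorus := ⟨_, hne (3 / 4)⟩
  have hp : circleCoord b p ∈ upperHalf := by
    rw [(circleCoord_center_add (p := p) b rfl).1]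
    exact ⟨_, ⟨by norm_num, by norm_num⟩, rfl⟩
  have hq : circleCoord b q ∈ lowerHalf := by
    rw [(circleCoord_center_add (p := q) b rfl).1,
      show (1 / 2 + 3 / 4 : ℝ) = 1 / 4 + 1 by norm_num, AddCircle.coe_add_period]
    exact ⟨_, ⟨by norm_num, by norm_num⟩, rfl⟩
  have e : gen b = (genPart b 0 (1 / 4) h0 rfl).trans
      ((genPart b (1 / 4) (3 / 4) (p := p) (q := q) rfl rfl).trans
        (genPart b (3 / 4) 1 rfl h1)) := by
    unfold genPart
    rw [chord_trans, chord_trans]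
    exact (chord_dir_eq_gen (b := b) _ _ _ _ _ (by simp)).symm
  rw [e, IsCoveringMap.monodromy_trans_apply, IsCoveringMap.monodromy_trans_apply,
    monodromy_genPart (i := none) (by norm_num), monodromy_genPart (i := some b) (by norm_num),
    monodromy_genPart (i := none) (by norm_num)]
  · simp only [chartFactor, if_pos hq, if_neg fun hl => Set.disjoint_left.1 disjoint_halves hl hp]
    simp
  · intro r hr p' hp'
    refine mem_chartSet_none_of_center_add hp' ?_
    rw [show 1 / 2 + r = (r - 1 / 2) + 1 by ring, AddCircle.coe_add_period]
    exact coe_circle_ne_zero (by linarith [hr.1]) (by linarith [hr.2])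
  · intro r hr p' hp'
    exact mem_chartSet_some_of_center_add hp' (by linarith [hr.1]) (by linarith [hr.2])
  · intro r hr p' hp'
    exact mem_chartSet_none_of_center_add hp'
      (coe_circle_ne_zero (by linarith [hr.1]) (by linarith [hr.2]))

/-- The homomorphism from the free group that sends its generators to the loops `gen`. -/
def freeHom : FreeGroup Bool →* FundamentalGroup PuncturedTorus basePoint := FreeGroup.lift gen

/-- The monodromy over the base point is the left regular representation of the free group. -/
theorem monodromy_freeHom (w u : FreeGroup Bool) :
    isCoveringMap_freeBundle.monodromy (freeHom w) (bundlePoint basePoint u) =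
      bundlePoint basePoint (w * u) := by
  have hinv : ∀ (g : FundamentalGroup PuncturedTorus basePoint) (w : FreeGroup Bool),
      (∀ u, isCoveringMap_freeBundle.monodromyPerm basePoint g (bundlePoint basePoint u) =
        bundlePoint basePoint (w * u)) →
      ∀ u, isCoveringMap_freeBundle.monodromyPerm basePoint g⁻¹ (bundlePoint basePoint u) =
        bundlePoint basePoint (w⁻¹ * u) := fun g w h u => by
    rw [map_inv, Equiv.Perm.inv_eq_iff_eq, h, mul_inv_cancel_left]
  change isCoveringMap_freeBundle.monodromyPerm basePoint _ _ = _
  induction w using FreeGroup.induction_on generalizing u with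
  | C1 => rw [map_one, map_one, Equiv.Perm.one_apply, one_mul]
  | of b =>
    rw [freeHom, FreeGroup.lift_apply_of]
    exact monodromy_gen b u
  | inv_of b ih =>
    rw [map_inv]
    exact hinv _ _ ih u
  | mul v w hv hw => rw [map_mul, map_mul, Equiv.Perm.mul_apply, hw, hv, mul_assoc]

/-- Injectivity holds because the left regular representation is faithful, surjectivity because the
loops `gen` generate the fundamental group. -/
theorem freeHom_bijective : Function.Bijective freeHom := by
  constructor
  · intro v w h
    have hv := monodromy_freeHom v 1
    rw [h, monodromy_freeHom w 1] at hv
    simpa using bundlePoint_injective _ hv.symm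
  · rw [← MonoidHom.range_eq_top, freeHom, FreeGroup.range_lift_eq_closure, closure_range_gen]

/-- The fundamental group of the punctured torus is free on the loops `gen false`, `gen true`. -/
def freeEquiv : FreeGroup Bool ≃* FundamentalGroup PuncturedTorus basePoint :=
  MulEquiv.ofBijective freeHom freeHom_bijective

theorem freeEquiv_of (b : Bool) : freeEquiv (FreeGroup.of b) = gen b :=
  FreeGroup.lift_apply_of (f := gen) (x := b)

/-! ### The half turn in the punctured torus -/

/-- Change of base point along a path class. -/
def conjEquiv {X : Type*} [TopologicalSpace X] {a b : X} (κ : Path.Homotopic.Quotient a b) :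
    FundamentalGroup X a ≃* FundamentalGroup X b where
  toFun g := κ.symm.trans (Path.Homotopic.Quotient.trans g κ)
  invFun g := κ.trans (Path.Homotopic.Quotient.trans g κ.symm)
  left_inv g := by
    change κ.trans (.trans (κ.symm.trans (.trans g κ)) κ.symm) = g
    grind
  right_inv g := by
    change κ.symm.trans (.trans (κ.trans (.trans g κ.symm)) κ) = g
    grind
  map_mul' g h := by
    change κ.symm.trans (.trans (Path.Homotopic.Quotient.trans h g) κ) =
      Path.Homotopic.Quotient.trans (κ.symm.trans (.trans h κ)) (κ.symm.trans (.trans g κ))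
    grind

theorem conjEquiv_apply {X : Type*} [TopologicalSpace X] {a b : X}
    (κ : Path.Homotopic.Quotient a b) (g : FundamentalGroup X a) :
    conjEquiv κ g = κ.symm.trans (Path.Homotopic.Quotient.trans g κ) := rfl

theorem map_quotient_trans {X Y : Type*} [TopologicalSpace X] [TopologicalSpace Y] {a b c : X}
    (α : Path.Homotopic.Quotient a b) (β : Path.Homotopic.Quotient b c) (f : C(X, Y)) :
    (α.trans β).map f = (α.map f).trans (β.map f) := by
  induction α with | mk γ =>
  induction β with | mk δ =>
  exact congrArg Path.Homotopic.Quotient.mk (γ.map_trans δ f.continuous)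

theorem map_quotient_symm {X Y : Type*} [TopologicalSpace X] [TopologicalSpace Y] {a b : X}
    (α : Path.Homotopic.Quotient a b) (f : C(X, Y)) : α.symm.map f = (α.map f).symm := by
  induction α with | mk γ => rfl

theorem quotient_trans_symm {X : Type*} [TopologicalSpace X] {a b c : X}
    (α : Path.Homotopic.Quotient a b) (β : Path.Homotopic.Quotient b c) :
    (α.trans β).symm = β.symm.trans α.symm := by
  induction α with | mk γ =>
  induction β with | mk δ =>
  exact congrArg Path.Homotopic.Quotient.mk (γ.trans_symm δ)

/-- The two ways around the boundary of a square are homotopic. -/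
theorem mk_trans_eq_of_square {X : Type*} [TopologicalSpace X] {a b c d : X} (F : C(I × I, X))
    {p : Path a b} {q : Path b d} {p' : Path c d} {q' : Path a c} (hp : ∀ t, p t = F (t, 0))
    (hq : ∀ t, q t = F (1, t)) (hq' : ∀ t, q' t = F (0, t)) (hp' : ∀ t, p' t = F (t, 1)) :
    (Path.Homotopic.Quotient.mk p).trans (.mk q) =
      (Path.Homotopic.Quotient.mk q').trans (.mk p') := by
  let diag : Path (0 : I) 1 := ⟨⟨fun t => t, continuous_id⟩, rfl, rfl⟩
  have : ContractibleSpace I :=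
    (convex_Icc (0 : ℝ) 1).contractibleSpace ⟨0, by simp⟩
  have h := SimplyConnectedSpace.paths_homotopic
    ((diag.prod (.refl 0)).trans ((Path.refl 1).prod diag))
    (((Path.refl 0).prod diag).trans (diag.prod (.refl 1)))
  have ha : a = F (0, 0) := by simpa using hp 0
  have hd : d = F (1, 1) := by simpa using hq 1
  have e1 : p.trans q = ((((diag.prod (.refl 0)).trans ((Path.refl 1).prod diag))).map
      F.continuous).cast ha hd := by
    ext t
    simp only [Path.trans_apply, Path.cast_coe, Path.map_coe, Function.comp_apply]
    split_ifs
    · exact hp _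
    · exact hq _
  have e2 : q'.trans p' = (((((Path.refl 0).prod diag).trans (diag.prod (.refl 1)))).map
      F.continuous).cast ha hd := by
    ext t
    simp only [Path.trans_apply, Path.cast_coe, Path.map_coe, Function.comp_apply]
    split_ifs
    · exact hq' _
    · exact hp' _
  rw [← Path.Homotopic.Quotient.mk_trans, ← Path.Homotopic.Quotient.mk_trans,
    Path.Homotopic.Quotient.eq, e1, e2]
  exact Path.Homotopic.pathCast (h.map F) _ _

/-- The involution `u ↦ -u` of the punctured torus. -/
def negMap : C(PuncturedTorus, PuncturedTorus) :=
  ⟨fun u => ⟨-u.1, neg_ne_zero.2 u.2⟩, continuous_subtype_val.neg.subtype_mk _⟩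

theorem toTorus_neg_eq {z : ℂ} {p : PuncturedTorus} (h : toTorus z = p) :
    toTorus (-z) = negMap p := by
  rw [toTorus_neg, h]
  rfl

/-- The planar half turn `t ↦ exp(iπt) w` from `w` to `w' = -w`. -/
def halfTurn {w w' : ℂ} (h : w' = -w) : Path w w' where
  toFun t := rot t * w
  continuous_toFun := continuous_rot.mul continuous_const
  source' := by simp [rot_zero]
  target' := by simp [rot_one, h]

theorem toTorus_rot_mul_ne_zero {w : ℂ} (h0 : w ≠ 0) (h1 : ‖w‖ < 1) (t : I) :
    toTorus (rot t * w) ≠ 0 :=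
  toTorus_ne_zero (mul_ne_zero (Complex.exp_ne_zero _) h0) (by rwa [norm_mul, norm_rot, one_mul])

/-- The class of the half turn about `0` in the punctured torus. -/
def turn {w w' : ℂ} (h : w' = -w) (h0 : w ≠ 0) (h1 : ‖w‖ < 1) {p q : PuncturedTorus}
    (hp : toTorus w = p) (hq : toTorus w' = q) : Path.Homotopic.Quotient p q :=
  .mk (planarPath (halfTurn h) (toTorus_rot_mul_ne_zero h0 h1) hp hq)

/-- Sliding the half turn along a path in the punctured unit disc. -/
theorem turn_trans {w z w' z' : ℂ} {k : Path w z} {k' : Path w' z'} (hk' : ∀ t, k' t = -k t)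
    (h0 : ∀ t, k t ≠ 0) (h1 : ∀ t, ‖k t‖ < 1) {p q p' q' : PuncturedTorus} {γ : Path p q}
    {γ' : Path p' q'} (hγ : ∀ t, toTorus (k t) = γ t) (hγ' : ∀ t, toTorus (k' t) = γ' t)
    (hw : w' = -w) (hz : z' = -z) (hw0 : w ≠ 0) (hw1 : ‖w‖ < 1) (hz0 : z ≠ 0) (hz1 : ‖z‖ < 1)
    (hp : toTorus w = p) (hq : toTorus z = q) (hp' : toTorus w' = p') (hq' : toTorus z' = q') :
    (turn hw hw0 hw1 hp hp').trans (.mk γ') =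
      (Path.Homotopic.Quotient.mk γ).trans (turn hz hz0 hz1 hq hq') := by
  have hr := continuous_rot
  refine mk_trans_eq_of_square ⟨fun x => ⟨toTorus (rot x.1 * k x.2),
    toTorus_rot_mul_ne_zero (h0 x.2) (h1 x.2) x.1⟩,
    (continuous_toTorus.comp (by fun_prop)).subtype_mk _⟩ ?_ ?_ ?_ ?_ <;> intro t <;>
    apply Subtype.ext
  · change toTorus (rot t * w) = toTorus (rot t * k 0)
    simp
  · change _ = toTorus (rot 1 * k t)
    rw [← hγ', hk', rot_one, neg_one_mul]
  · change _ = toTorus (rot 0 * k t)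
    rw [← hγ, rot_zero, one_mul]
  · change toTorus (rot t * z) = toTorus (rot t * k 1)
    simp

/-- The punctured unit disc is path connected: the geometric interpolation `w * (z / w) ^ t` has a
norm that lies between `‖w‖` and `‖z‖`. -/
theorem exists_path_punctured_disc {w z : ℂ} (hw0 : w ≠ 0) (hw1 : ‖w‖ < 1) (hz0 : z ≠ 0)
    (hz1 : ‖z‖ < 1) : ∃ k : Path w z, ∀ t, k t ≠ 0 ∧ ‖k t‖ < 1 := by
  let k : Path w z := ⟨⟨fun t => w * Complex.exp ((t : ℝ) * Complex.log (z / w)), by fun_prop⟩,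
    by simp, by simp [Complex.exp_log (div_ne_zero hz0 hw0), mul_div_cancel₀ _ hw0]⟩
  refine ⟨k, fun t => ⟨mul_ne_zero hw0 (Complex.exp_ne_zero _), ?_⟩⟩
  have hwp : 0 < ‖w‖ := norm_pos_iff.2 hw0
  have hzp : 0 < ‖z‖ := norm_pos_iff.2 hz0
  have e : ‖k t‖ = Real.exp ((1 - t) * Real.log ‖w‖ + t * Real.log ‖z‖) := by
    change ‖w * Complex.exp ((t : ℝ) * Complex.log (z / w))‖ = _
    rw [norm_mul, Complex.norm_exp, Complex.re_ofReal_mul, Complex.log_re, norm_div,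
      Real.log_div hzp.ne' hwp.ne']
    nth_rw 1 [← Real.exp_log hwp]
    rw [← Real.exp_add]
    congr 1
    ring
  rw [e, Real.exp_lt_one_iff]
  have hlw := Real.log_neg hwp hw1
  have hlz := Real.log_neg hzp hz1
  rcases eq_or_lt_of_le t.2.1 with h | h
  · rw [← h]
    linarith
  · nlinarith [mul_neg_of_pos_of_neg h hlz, t.2.2]

theorem mk_eq_chord_trans_chord {S S' : Set ℂ} (hS : IsCell S) (hS' : IsCell S') {z w u : ℂ}
    {p q r : PuncturedTorus} {γ : Path p q} (f : Path z w) (hγ : ∀ t, toTorus (f t) = γ t)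
    {m : I} (hm : f m = u) (h1 : ∀ t ≤ m, f t ∈ S) (h2 : ∀ t, m ≤ t → f t ∈ S')
    (hz : z ∈ S) (hu : u ∈ S) (hu' : u ∈ S') (hw : w ∈ S') (hp : toTorus z = p)
    (hr : toTorus u = r) (hq : toTorus w = q) :
    Path.Homotopic.Quotient.mk γ = (chord hS hz hu hp hr).trans (chord hS' hu' hw hr hq) := by
  obtain rfl : r = γ m := Subtype.ext (by rw [← hr, ← hm, hγ])
  subst hm
  rw [← mk_eq_chord hS (γ := (γ.subpath 0 m).cast γ.source.symm rfl)
      ((f.subpath 0 m).cast f.source.symm rfl) (fun t => h1 _ ?_) (fun t => hγ _),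
    ← mk_eq_chord hS' (γ := (γ.subpath m 1).cast rfl γ.target.symm)
      ((f.subpath m 1).cast rfl f.target.symm) (fun t => h2 _ ?_) (fun t => hγ _),
    ← Path.Homotopic.Quotient.mk_trans, Path.Homotopic.Quotient.eq]
  · have := Path.Homotopic.pathCast (⟨Path.Homotopy.subpathTransSubpath γ 0 m 1⟩ :
      Path.Homotopic _ _) γ.source.symm γ.target.symm
    rw [Path.subpath_zero_one] at this
    exact this.symm
  · have := Path.range_subpathAux m 1 ▸ Set.mem_range_self t
    rw [Set.uIcc_of_le (le_one' (t := m))] at this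
    exact this.1
  · have := Path.range_subpathAux 0 m ▸ Set.mem_range_self t
    rw [Set.uIcc_of_le (nonneg' (t := m))] at this
    exact this.2

/-! ### The half turn of the base point -/

theorem rot_re (t : I) : (rot t).re = Real.cos (t * Real.pi) := by
  rw [rot, Complex.exp_ofReal_mul_I_re]

theorem rot_im (t : I) : (rot t).im = Real.sin (t * Real.pi) := by
  rw [rot, Complex.exp_ofReal_mul_I_im]

/-- The midpoint of the unit interval. -/
def mid : I := ⟨1 / 2, by norm_num, by norm_num⟩

theorem rot_mid : rot mid = Complex.I := by
  have h : ((mid : ℝ) * Real.pi) = Real.pi / 2 := by rw [mid]; ring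
  exact Complex.ext (by rw [rot_re, h, Real.cos_pi_div_two, Complex.I_re])
    (by rw [rot_im, h, Real.sin_pi_div_two, Complex.I_im])

theorem rot_im_nonneg (t : I) : 0 ≤ (rot t).im := by
  rw [rot_im]
  exact Real.sin_nonneg_of_nonneg_of_le_pi (mul_nonneg t.2.1 Real.pi_pos.le)
    (mul_le_of_le_one_left Real.pi_pos.le t.2.2)

theorem rot_re_nonneg {t : I} (ht : t ≤ mid) : 0 ≤ (rot t).re := by
  rw [rot_re]
  have h : (t : ℝ) ≤ 1 / 2 := ht
  have h0 := mul_nonneg t.2.1 Real.pi_pos.le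
  refine Real.cos_nonneg_of_neg_pi_div_two_le_of_le ?_ ?_ <;> nlinarith [Real.pi_pos]

theorem rot_re_nonpos {t : I} (ht : mid ≤ t) : (rot t).re ≤ 0 := by
  rw [rot_re]
  have h : 1 / 2 ≤ (t : ℝ) := ht
  have h1 := t.2.2
  refine Real.cos_nonpos_of_pi_div_two_le_of_le ?_ ?_ <;> nlinarith [Real.pi_pos]

theorem rot_sq (t : I) : (rot t).re ^ 2 + (rot t).im ^ 2 = 1 := by
  rw [rot_re, rot_im, Real.cos_sq_add_sin_sq]

theorem sum_bounds_of_sq_add_sq {a b : ℝ} (h : a ^ 2 + b ^ 2 = 1) (ha : 0 ≤ a) (hb : 0 ≤ b) :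
    0 < a + b ∧ a + b < 2 := by
  constructor
  · by_contra! hn
    have ha' : a = 0 := by linarith
    have hb' : b = 0 := by linarith
    rw [ha', hb'] at h
    norm_num at h
  · nlinarith [sq_nonneg (a - b)]

theorem center_re : center.re = 1 / 2 := by simp [center]

theorem center_im : center.im = -1 / 2 := by simp [center]

theorem rot_mul_center_mem_of_le {t : I} (ht : t ≤ mid) : rot t * center ∈ strip true 0 := by
  obtain ⟨h1, h2⟩ := sum_bounds_of_sq_add_sq (rot_sq t) (rot_re_nonneg ht) (rot_im_nonneg t)
  have e : coord true (rot t * center) = ((rot t).re + (rot t).im) / 2 := by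
    simp only [coord, Complex.reLm_coe, Complex.mul_re, center_re, center_im]; ring
  rw [strip, Set.mem_ofPred_eq, e]
  norm_num
  constructor <;> linarith

theorem rot_mul_center_mem_of_ge {t : I} (ht : mid ≤ t) : rot t * center ∈ strip false 0 := by
  obtain ⟨h1, h2⟩ := sum_bounds_of_sq_add_sq (a := -(rot t).re) (by rw [neg_sq, rot_sq])
    (neg_nonneg.2 (rot_re_nonpos ht)) (rot_im_nonneg t)
  have e : coord false (rot t * center) = (-(rot t).re + (rot t).im) / 2 := by
    simp only [coord, Complex.imLm_coe, Complex.mul_im, center_re, center_im]; ring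
  rw [strip, Set.mem_ofPred_eq, e]
  norm_num
  constructor <;> linarith

theorem neg_mem_strip {b : Bool} {n : ℤ} {z : ℂ} (hz : z ∈ strip b n) : -z ∈ strip b (-n - 1) := by
  have h := hz
  rw [strip, Set.mem_ofPred_eq] at h ⊢
  rw [map_neg]
  push_cast at h ⊢
  constructor <;> linarith [h.1, h.2]

theorem toTorus_center : toTorus center = basePoint := rfl

theorem center_ne_zero : center ≠ 0 := by
  intro h
  have := congrArg Complex.re h
  rw [center_re] at this
  norm_num at this

theorem norm_center_lt_one : ‖center‖ < 1 := by
  rw [← sq_lt_one_iff₀ (norm_nonneg _), Complex.sq_norm, Complex.normSq_apply, center_re, center_im]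
  norm_num

theorem rot_mid_mul_center : rot mid * center = center + Complex.I := by
  rw [rot_mid]
  apply Complex.ext <;> simp [center_re, center_im] <;> norm_num

theorem neg_center_eq : -center = center + Complex.I - 1 := by
  apply Complex.ext <;> simp [center_re, center_im] <;> norm_num

theorem negMap_basePoint : negMap basePoint = basePoint := by
  apply Subtype.ext
  change -toTorus center = toTorus center
  rw [← toTorus_neg, neg_center_eq, toTorus_sub, toTorus_add, toTorus_I, toTorus_one, add_zero,
    sub_zero]

theorem toTorus_neg_center : toTorus (-center) = basePoint := by
  rw [toTorus_neg_eq (p := basePoint) rfl, negMap_basePoint]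

theorem turn_center :
    turn (w := center) rfl center_ne_zero norm_center_lt_one (p := basePoint) (q := basePoint)
      toTorus_center toTorus_neg_center =
    ((gen false)⁻¹ * gen true : FundamentalGroup PuncturedTorus basePoint) := by
  have h0 : center ∈ strip true 0 := center_mem_strip true
  have hm := rot_mul_center_mem_of_le (le_refl mid)
  have hm' := rot_mul_center_mem_of_ge (le_refl mid)
  have h1 : -center ∈ strip false 0 := by
    simpa [rot_one] using rot_mul_center_mem_of_ge (t := 1) le_one'
  rw [rot_mid_mul_center] at hm hm'
  have hr : toTorus (center + Complex.I) = basePoint := toTorus_center_add toTorus_I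
  refine (mk_eq_chord_trans_chord (isCell_strip true 0) (isCell_strip false 0)
    (halfTurn rfl) (fun t => rfl) (m := mid) rot_mid_mul_center
    (fun t ht => rot_mul_center_mem_of_le ht) (fun t ht => rot_mul_center_mem_of_ge ht)
    h0 hm hm' h1 toTorus_center hr toTorus_neg_center).trans ?_
  rw [chord_dir_eq_gen (b := true) (isCell_strip true 0) h0 hm toTorus_center hr (by simp [dir]),
    chord_neg_dir_eq_gen_inv (b := false) (isCell_strip false 0) hm' h1 hr _
      (by rw [neg_center_eq]; simp [dir])]
  rfl

theorem turn_neg_center {p : PuncturedTorus} (hp : toTorus (-center) = p) :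
    turn (w := -center) (w' := center) (neg_neg _).symm (neg_ne_zero.2 center_ne_zero)
      (by rw [norm_neg]; exact norm_center_lt_one) (q := basePoint) hp toTorus_center =
    Path.Homotopic.Quotient.cast (FundamentalGroup.toPath (gen false * (gen true)⁻¹))
      (Subtype.ext (hp.symm.trans toTorus_neg_center)) rfl := by
  obtain rfl : basePoint = p := Subtype.ext (toTorus_neg_center.symm.trans hp)
  have h0 : -center ∈ strip true (-1) := neg_mem_strip (center_mem_strip true)
  have hs : ∀ t, t ≤ mid → rot t * -center ∈ strip true (-1) := fun t ht => by
    rw [mul_neg]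
    exact neg_mem_strip (rot_mul_center_mem_of_le ht)
  have hs' : ∀ t, mid ≤ t → rot t * -center ∈ strip false (-1) := fun t ht => by
    rw [mul_neg]
    exact neg_mem_strip (rot_mul_center_mem_of_ge ht)
  have hmid : rot mid * -center = -center - Complex.I := by
    rw [mul_neg, rot_mid_mul_center]; ring
  have hm := hs mid le_rfl
  have hm' := hs' mid le_rfl
  have h1 : center ∈ strip false (-1) := center_mem_strip false
  rw [hmid] at hm hm'
  have hr : toTorus (-center - Complex.I) = basePoint := by
    rw [toTorus_sub, toTorus_I, sub_zero, toTorus_neg_center]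
  rw [Path.Homotopic.Quotient.cast_rfl_rfl]
  refine (mk_eq_chord_trans_chord (isCell_strip true (-1)) (isCell_strip false (-1))
    (halfTurn _) (fun t => rfl) (m := mid) hmid hs hs'
    h0 hm hm' h1 hp hr toTorus_center).trans ?_
  rw [chord_neg_dir_eq_gen_inv (b := true) (isCell_strip true (-1)) h0 hm hp hr (by simp [dir]),
    chord_dir_eq_gen (b := false) (isCell_strip false (-1)) hm' h1 hr toTorus_center (by
      rw [neg_center_eq]; simp only [dir]; ring)]
  rfl

theorem chord_eq_cast {S : Set ℂ} (hS : IsCell S) {z w : ℂ} (hz : z ∈ S) (hw : w ∈ S)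
    {p q p' q' : PuncturedTorus} (hp : toTorus z = p) (hq : toTorus w = q) (hpp : p' = p)
    (hqq : q' = q) :
    chord hS hz hw (p := p') (q := q') (by rw [hp, hpp]) (by rw [hq, hqq]) =
      (chord hS hz hw hp hq).cast hpp hqq := by
  subst hpp hqq
  simp

theorem map_negMap_gen (b : Bool) : Path.Homotopic.Quotient.map (gen b) negMap =
    Path.Homotopic.Quotient.cast (FundamentalGroup.toPath (gen b)⁻¹)
      negMap_basePoint negMap_basePoint := by
  have hz := neg_mem_strip (center_mem_strip b)
  have hw := neg_mem_strip (center_add_dir_mem_strip b)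
  have hq : toTorus (-(center + dir b)) = basePoint := by
    rw [toTorus_neg_eq (p := basePoint) (toTorus_center_add (toTorus_dir b)), negMap_basePoint]
  have hi := chord_neg_dir_eq_gen_inv (b := b) (isCell_strip b _) hz hw toTorus_neg_center hq
    (by ring)
  rw [← hi]
  refine Eq.trans ?_ (chord_eq_cast (isCell_strip b _) hz hw toTorus_neg_center hq _ _)
  refine mk_eq_chord (isCell_strip b _)
    (γ := (planarPath (.segment center (center + dir b)) _ _ _).map negMap.continuous)
    ((Path.segment center (center + dir b)).map continuous_neg) (fun t => ?_) (fun t => ?_) hz hw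
    _ _
  · exact neg_mem_strip (segment_mem (isCell_strip b _).convex (center_mem_strip b)
      (center_add_dir_mem_strip b) t)
  · change toTorus (-Path.segment center (center + dir b) t) = _
    rw [toTorus_neg]
    rfl

/-- The effect of the half turn on the loops `gen b`: each is inverted by `u ↦ -u` and conjugated
by the class of the half turn. -/
theorem turn_conj_gen (b : Bool) {ρ : Path.Homotopic.Quotient (negMap basePoint) basePoint}
    (hρ : ρ = turn (w := -center) (w' := center) (neg_neg _).symm (neg_ne_zero.2 center_ne_zero)
      (by rw [norm_neg]; exact norm_center_lt_one) (toTorus_neg_eq (p := basePoint) rfl) rfl) :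
    (ρ.symm.trans (.trans (Path.Homotopic.Quotient.map (gen b) negMap) ρ) :
      FundamentalGroup PuncturedTorus basePoint) =
      gen false * (gen true)⁻¹ * (gen b)⁻¹ * (gen false * (gen true)⁻¹)⁻¹ := by
  rw [turn_neg_center] at hρ
  subst hρ
  rw [map_negMap_gen b]
  have h : ∀ (p : PuncturedTorus) (hp : p = basePoint)
      (r g : FundamentalGroup PuncturedTorus basePoint),
      ((Path.Homotopic.Quotient.cast r hp rfl).symm.trans
        (.trans (Path.Homotopic.Quotient.cast g hp hp) (.cast r hp rfl)) :
        FundamentalGroup PuncturedTorus basePoint) = r * g * r⁻¹ := by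
    rintro p rfl r g
    simp only [Path.Homotopic.Quotient.cast_rfl_rfl]
    rfl
  exact h _ _ _ _

/-- The full turn about `0` is the commutator `x y⁻¹ x⁻¹ y`. -/
theorem turn_trans_turn {η : Path.Homotopic.Quotient basePoint (negMap basePoint)}
    {ρ : Path.Homotopic.Quotient (negMap basePoint) basePoint}
    (hη : η = turn (w := center) rfl center_ne_zero norm_center_lt_one rfl
      (toTorus_neg_eq (p := basePoint) rfl))
    (hρ : ρ = turn (w := -center) (w' := center) (neg_neg _).symm (neg_ne_zero.2 center_ne_zero)
      (by rw [norm_neg]; exact norm_center_lt_one) (toTorus_neg_eq (p := basePoint) rfl) rfl) :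
    (η.trans ρ : FundamentalGroup PuncturedTorus basePoint) =
      gen false * (gen true)⁻¹ * (gen false)⁻¹ * gen true := by
  have h : ∀ (p : PuncturedTorus) (hp : p = basePoint) (hq : toTorus (-center) = p)
      (r : FundamentalGroup PuncturedTorus basePoint),
      (Path.Homotopic.Quotient.trans (turn (w := center) rfl center_ne_zero norm_center_lt_one
        (p := basePoint) rfl hq) (.cast r hp rfl) :
        FundamentalGroup PuncturedTorus basePoint) = r * ((gen false)⁻¹ * gen true) := by
    rintro p rfl hq r
    rw [turn_center, Path.Homotopic.Quotient.cast_rfl_rfl]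
    rfl
  rw [turn_neg_center] at hρ
  subst hη hρ
  refine (h _ negMap_basePoint _ _).trans ?_
  group

/-! ### The orbit covering of the configuration space -/

theorem swap_swap {N : Type*} (p : Conf N) : swap (swap p) = p := rfl

theorem swap_ne_self {N : Type*} (p : Conf N) : swap p ≠ p := fun h =>
  p.2 (congrArg (fun q : Conf N => q.1.2) h)

/-- The exchange of the two points as a continuous map. -/
def swapMap (N : Type*) [TopologicalSpace N] : C(Conf N, Conf N) :=
  ⟨swap, by unfold swap; fun_prop⟩

theorem confProj_swap {N : Type*} [TopologicalSpace N] (p : Conf N) :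
    confProj N (swap p) = confProj N p := Quotient.sound (Or.inr rfl)

/-- The action of the group `{1, -1}` on the configuration space in which `-1` acts by `swap`. -/
@[reducible] def confAction (N : Type*) : MulAction ℤˣ (Conf N) where
  smul u p := if u = 1 then p else swap p
  one_smul p := if_pos rfl
  mul_smul u w p := by
    change (if u * w = 1 then p else swap p) =
      if u = 1 then (if w = 1 then p else swap p) else swap (if w = 1 then p else swap p)
    rcases Int.units_eq_one_or u with rfl | rfl <;> rcases Int.units_eq_one_or w with rfl | rfl <;>
      simp [swap_swap]

theorem isCoveringMap_confProj (N : Type*) [TopologicalSpace N] [T2Space N]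
    [LocallyCompactSpace N] : IsCoveringMap (confProj N) := by
  let := confAction N
  have hone : ∀ p : Conf N, (1 : ℤˣ) • p = p := one_smul _
  have hneg : ∀ p : Conf N, (-1 : ℤˣ) • p = swap p := fun p => if_neg (by decide)
  have : ContinuousConstSMul ℤˣ (Conf N) := ⟨fun u => by
    rcases Int.units_eq_one_or u with rfl | rfl
    · simpa only [hone] using continuous_id'
    · simp only [hneg]
      exact (swapMap N).continuous⟩
  have : LocallyCompactSpace (Conf N) :=
    (isClosed_diagonal (X := N)).isOpen_compl.locallyCompactSpace
  have : IsCancelSMul ℤˣ (Conf N) := ⟨fun u w p h => by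
    rcases Int.units_eq_one_or u with rfl | rfl <;> rcases Int.units_eq_one_or w with rfl | rfl
    · rfl
    · rw [hone, hneg] at h
      exact absurd h.symm (swap_ne_self p)
    · rw [hone, hneg] at h
      exact absurd h (swap_ne_self p)
    · rfl⟩
  have hq : Topology.IsQuotientMap (confProj N) := isQuotientMap_quotient_mk'
  refine (hq.isQuotientCoveringMap_of_properlyDiscontinuousSMul (G := ℤˣ) ?_).isCoveringMap
  intro p q
  rw [MulAction.mem_orbit_iff]
  constructor
  · intro h
    rcases Quotient.exact h with h | h
    · exact ⟨1, by rw [hone]; exact h.symm⟩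
    · exact ⟨-1, by rw [hneg]; exact h.symm⟩
  · rintro ⟨u, rfl⟩
    rcases Int.units_eq_one_or u with rfl | rfl
    · rw [hone]
    · rw [hneg]
      exact confProj_swap q

theorem pureToFull_injective {N : Type*} [TopologicalSpace N] [T2Space N]
    [LocallyCompactSpace N] (n : Conf N) : Function.Injective (pureToFull n) :=
  (isCoveringMap_confProj N).injective_path_homotopic_map n n

section HalfTwist

variable {n₁ n₂ : Torus} (hn : n₁ ≠ n₂) {v : ℂ} (hv : ‖v‖ < 1) (hvn : n₂ = n₁ + toTorus v)

/-- The half twist does not lift to a loop, because its lift is a path from `n` to `swap n`. -/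
theorem sigma_notMem_range :
    sigma n₁ n₂ hn v hv hvn ∉ (pureToFull (⟨(n₁, n₂), hn⟩ : Conf Torus)).range := by
  rintro ⟨g, hg⟩
  have h1 := (isCoveringMap_confProj Torus).monodromy_map (x := ⟨(n₁, n₂), hn⟩)
    (y := ⟨(n₁, n₂), hn⟩) g
  have h2 := (isCoveringMap_confProj Torus).monodromy_eq_of_map_eq
    (γ := sigma n₁ n₂ hn v hv hvn) (ex := ⟨⟨(n₁, n₂), hn⟩, rfl⟩)
    (ey := ⟨swap ⟨(n₁, n₂), hn⟩, confProj_swap _⟩) (.mk (halfTwistPath n₁ n₂ hn v hv hvn)) rfl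
  rw [← hg] at h2
  exact swap_ne_self _ (congrArg Subtype.val (h2.symm.trans h1))

/-- The class of the second half of the full twist, which brings the two points back from
`swap n` to `n`. -/
def halfTwistBack : Path.Homotopic.Quotient (swapMap Torus ⟨(n₁, n₂), hn⟩) ⟨(n₁, n₂), hn⟩ :=
  .mk (((halfTwistPath n₁ n₂ hn v hv hvn).map (swapMap Torus).continuous).cast rfl rfl)

/-- Conjugation by the half twist, as an endomorphism of the pure braid group. -/
def conjSigma : PureBraid (⟨(n₁, n₂), hn⟩ : Conf Torus) →*
    PureBraid (⟨(n₁, n₂), hn⟩ : Conf Torus) :=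
  (conjEquiv (halfTwistBack hn hv hvn)).toMonoidHom.comp
    (FundamentalGroup.map (swapMap Torus) ⟨(n₁, n₂), hn⟩)

/-- The full twist as a pure braid. -/
def fullTwist : PureBraid (⟨(n₁, n₂), hn⟩ : Conf Torus) :=
  Path.Homotopic.Quotient.trans (.mk (halfTwistPath n₁ n₂ hn v hv hvn)) (halfTwistBack hn hv hvn)

theorem pureToFull_conjSigma (g : PureBraid (⟨(n₁, n₂), hn⟩ : Conf Torus)) :
    pureToFull _ (conjSigma hn hv hvn g) =
      sigma n₁ n₂ hn v hv hvn * pureToFull _ g * (sigma n₁ n₂ hn v hv hvn)⁻¹ := by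
  induction g using Path.Homotopic.Quotient.ind with | mk γ =>
  set τ : Path (swapMap Torus ⟨(n₁, n₂), hn⟩) ⟨(n₁, n₂), hn⟩ :=
    ((halfTwistPath n₁ n₂ hn v hv hvn).map (swapMap Torus).continuous).cast rfl rfl
  set s : Path (confProj Torus ⟨(n₁, n₂), hn⟩) (confProj Torus ⟨(n₁, n₂), hn⟩) :=
    ((halfTwistPath n₁ n₂ hn v hv hvn).map (confProj Torus).continuous).cast rfl
      (confProj_swap _).symm
  have hs : ∀ t, confProj Torus (τ t) = s t := fun t => confProj_swap _
  refine congrArg Path.Homotopic.Quotient.mk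
    (a₁ := (τ.symm.trans ((γ.map (swapMap Torus).continuous).trans τ)).map
      (confProj Torus).continuous)
    (a₂ := s.symm.trans ((γ.map (confProj Torus).continuous).trans s))
    (Path.ext (funext fun t => ?_))
  simp only [Path.trans_apply, Path.map_coe, Function.comp_apply, Path.symm_apply]
  split_ifs
  · exact hs _
  · exact confProj_swap _
  · exact hs _

theorem pureToFull_fullTwist :
    pureToFull _ (fullTwist hn hv hvn) = sigma n₁ n₂ hn v hv hvn ^ 2 := by
  rw [pow_two]
  set h := halfTwistPath n₁ n₂ hn v hv hvn
  set τ : Path (swap ⟨(n₁, n₂), hn⟩) ⟨(n₁, n₂), hn⟩ :=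
    (h.map (swapMap Torus).continuous).cast rfl rfl
  set s : Path (confProj Torus ⟨(n₁, n₂), hn⟩) (confProj Torus ⟨(n₁, n₂), hn⟩) :=
    (h.map (confProj Torus).continuous).cast rfl (confProj_swap _).symm
  refine congrArg Path.Homotopic.Quotient.mk
    (a₁ := (h.trans τ).map (confProj Torus).continuous)
    (a₂ := s.trans s) (Path.ext (funext fun t => ?_))
  simp only [Path.trans_apply, Path.map_coe, Function.comp_apply]
  split_ifs
  · rfl
  · exact confProj_swap _

end HalfTwist

/-! ### The product structure of the pure braid group -/

/-- The difference `(a, b) ↦ b - a` of the two points. -/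
def diffMap : C(Conf Torus, PuncturedTorus) :=
  ⟨fun p => ⟨p.1.2 - p.1.1, sub_ne_zero.2 p.2.symm⟩, by fun_prop⟩

/-- The pair of points with a given first point and a given difference. -/
def confOfDiff : C(PuncturedTorus × Torus, Conf Torus) :=
  ⟨fun p => ⟨(p.2, p.2 + p.1.1), fun h => p.1.2 (left_eq_add.1 h)⟩, by fun_prop⟩

theorem confOfDiff_diffMap (p : Conf Torus) :
    confOfDiff (diffMap p, firstPoint Torus p) = p :=
  Subtype.ext (Prod.ext rfl (add_sub_cancel _ _))

theorem diffMap_confOfDiff (p : PuncturedTorus × Torus) : diffMap (confOfDiff p) = p.1 :=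
  Subtype.ext (add_sub_cancel_left _ _)

/-- The isomorphism of the pure braid group with the product of the fundamental groups of the
punctured torus and of the torus given by the difference and the first point. -/
def pureBraidEquiv (n : Conf Torus) :
    PureBraid n ≃* FundamentalGroup PuncturedTorus (diffMap n) × FundamentalGroup Torus n.1.1 :=
  MulEquiv.ofBijective
    ((FundamentalGroup.map diffMap n).prod (firstPointHom n))
    ⟨fun g h hgh => by
      induction g using Path.Homotopic.Quotient.ind with | mk γ =>
      induction h using Path.Homotopic.Quotient.ind with | mk δ =>
      have h1 : (γ.map diffMap.continuous).Homotopic (δ.map diffMap.continuous) :=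
        Path.Homotopic.Quotient.eq.1 (congrArg Prod.fst hgh)
      have h2 : (γ.map (firstPoint Torus).continuous).Homotopic
          (δ.map (firstPoint Torus).continuous) :=
        Path.Homotopic.Quotient.eq.1 (congrArg Prod.snd hgh)
      have key : ∀ ε : Path n n, ε = (((ε.map diffMap.continuous).prod
          (ε.map (firstPoint Torus).continuous)).map confOfDiff.continuous).cast
          (confOfDiff_diffMap n).symm (confOfDiff_diffMap n).symm := fun ε => by
        ext1
        funext t
        exact (confOfDiff_diffMap (ε t)).symm
      rw [Path.Homotopic.Quotient.eq, key γ, key δ]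
      exact Path.Homotopic.pathCast (Path.Homotopic.map
        (Nonempty.map2 Path.Homotopic.prodHomotopy h1 h2) confOfDiff) _ _,
    fun ⟨β, α⟩ => by
      induction β using Path.Homotopic.Quotient.ind with | mk β =>
      induction α using Path.Homotopic.Quotient.ind with | mk α =>
      refine ⟨.mk (((β.prod α).map confOfDiff.continuous).cast
        (confOfDiff_diffMap n).symm (confOfDiff_diffMap n).symm), Prod.ext ?_ ?_⟩
      · refine congrArg Path.Homotopic.Quotient.mk (a₂ := β) (Path.ext (funext fun t => ?_))
        exact diffMap_confOfDiff (β t, α t)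
      · exact congrArg Path.Homotopic.Quotient.mk (a₂ := α) (Path.ext (funext fun t => rfl))⟩

/-! ### The half twist in product coordinates -/

/-- The inclusion of the punctured torus into the torus. -/
def puncturedIncl : C(PuncturedTorus, Torus) := ⟨Subtype.val, continuous_subtype_val⟩

/-- The second point of a pair. -/
def secondPoint : C(Conf Torus, Torus) := ⟨fun p => p.1.2, by fun_prop⟩

/-- A lift of the first point plus a lift of the difference is a lift of the second point. -/
theorem disp_secondPoint {a b : Conf Torus} (α : Path.Homotopic.Quotient a b) :
    disp (α.map secondPoint) =
      disp (α.map (firstPoint Torus)) + disp ((α.map diffMap).map puncturedIncl) := by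
  induction α with | mk γ =>
  obtain ⟨z, hz⟩ := isOpenQuotientMap_toTorus.surjective a.1.1
  obtain ⟨z', hz'⟩ := isOpenQuotientMap_toTorus.surjective (a.1.2 - a.1.1)
  obtain ⟨w, f, hf⟩ := exists_toTorus_lift (γ.map (firstPoint Torus).continuous) hz
  obtain ⟨w', f', hf'⟩ := exists_toTorus_lift
    ((γ.map diffMap.continuous).map puncturedIncl.continuous) hz'
  have h1 := disp_mk f hf
  have h2 := disp_mk f' hf'
  have h3 : disp (.mk (γ.map secondPoint.continuous)) = (w + w') - (z + z') := by
    refine disp_mk ⟨⟨fun t => f t + f' t, by fun_prop⟩, by simp, by simp⟩ fun t => ?_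
    change toTorus (f t + f' t) = (γ t).1.2
    rw [toTorus_add, hf, hf']
    exact add_sub_cancel _ _
  refine h3.trans ?_
  refine Eq.trans ?_ (congrArg₂ (· + ·) h1 h2).symm
  ring

theorem disp_puncturedIncl_conj {p q : PuncturedTorus} (κ : Path.Homotopic.Quotient p q)
    (g : FundamentalGroup PuncturedTorus p) :
    disp (Path.Homotopic.Quotient.map (conjEquiv κ g) puncturedIncl) =
      disp (Path.Homotopic.Quotient.map g puncturedIncl) := by
  rw [conjEquiv_apply, map_quotient_trans, map_quotient_trans, map_quotient_symm, disp_trans,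
    disp_trans, disp_symm]
  ring

theorem disp_puncturedIncl_gen (b : Bool) :
    disp (Path.Homotopic.Quotient.map (gen b) puncturedIncl) = dir b :=
  (disp_mk (Path.segment center (center + dir b)) fun _ => rfl).trans (by ring)

/-- The automorphism of the fundamental group of the punctured torus given by `u ↦ -u`, followed by
the change of base point along the half turn `ρ`. -/
def turnHom {d : PuncturedTorus} (ρ : Path.Homotopic.Quotient (negMap d) d) :
    FundamentalGroup PuncturedTorus d →* FundamentalGroup PuncturedTorus d :=
  (conjEquiv ρ).toMonoidHom.comp (FundamentalGroup.map negMap d)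

/-- A choice of base point change that carries the half turns of `w` to those of `center`. -/
theorem exists_conj_turn {w : ℂ} {d : PuncturedTorus} (hd : toTorus w = d) (hw0 : w ≠ 0)
    (hw1 : ‖w‖ < 1) {η : Path.Homotopic.Quotient d (negMap d)}
    {ρ : Path.Homotopic.Quotient (negMap d) d}
    (hη : η = turn (w := w) rfl hw0 hw1 hd (toTorus_neg_eq hd))
    (hρ : ρ = turn (w := -w) (w' := w) (neg_neg w).symm (neg_ne_zero.2 hw0)
      (by rwa [norm_neg]) (toTorus_neg_eq hd) hd) :
    ∃ κ : Path.Homotopic.Quotient basePoint d,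
      (∀ b, turnHom ρ (conjEquiv κ (gen b)) =
        conjEquiv κ (gen false * (gen true)⁻¹ * (gen b)⁻¹ * (gen false * (gen true)⁻¹)⁻¹)) ∧
      η.trans ρ = conjEquiv κ (gen false * (gen true)⁻¹ * (gen false)⁻¹ * gen true) := by
  obtain ⟨k, hk⟩ := exists_path_punctured_disc center_ne_zero norm_center_lt_one hw0 hw1
  set γ : Path basePoint d := planarPath k (fun t => toTorus_ne_zero (hk t).1 (hk t).2) rfl hd
  let k' : Path (-center) (-w) := k.map continuous_neg
  have hcn : toTorus (-center) = negMap basePoint := toTorus_neg_eq rfl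
  have e1 := turn_trans (k := k) (k' := k') (fun _ => rfl) (fun t => (hk t).1) (fun t => (hk t).2)
    (γ := γ) (γ' := γ.map negMap.continuous) (fun _ => rfl) (fun _ => toTorus_neg _) rfl rfl
    center_ne_zero norm_center_lt_one hw0 hw1 toTorus_center hd hcn (toTorus_neg_eq hd)
  have e2 := turn_trans (k := k') (k' := k) (fun t => (neg_neg (k t)).symm)
    (fun t => neg_ne_zero.2 (hk t).1) (fun t => (norm_neg (k t)).trans_lt (hk t).2)
    (γ := γ.map negMap.continuous) (γ' := γ) (fun _ => toTorus_neg _) (fun _ => rfl)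
    (neg_neg _).symm (neg_neg w).symm (neg_ne_zero.2 center_ne_zero)
    (by rw [norm_neg]; exact norm_center_lt_one) (neg_ne_zero.2 hw0) (by rwa [norm_neg]) hcn
    (toTorus_neg_eq hd) toTorus_center hd
  rw [← hη] at e1
  rw [← hρ] at e2
  obtain ⟨ηc, hηc⟩ : ∃ ηc, ηc = turn (w := center) rfl center_ne_zero norm_center_lt_one
    toTorus_center hcn := ⟨_, rfl⟩
  obtain ⟨ρc, hρc⟩ : ∃ ρc, ρc = turn (w := -center) (w' := center) (neg_neg _).symm
    (neg_ne_zero.2 center_ne_zero) (by rw [norm_neg]; exact norm_center_lt_one) hcn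
    toTorus_center := ⟨_, rfl⟩
  rw [← hηc] at e1
  rw [← hρc] at e2
  obtain ⟨κ, hκ⟩ : ∃ κ, κ = Path.Homotopic.Quotient.mk γ := ⟨_, rfl⟩
  rw [Path.Homotopic.Quotient.mk_map, ← hκ] at e1 e2
  refine ⟨κ, fun b => ?_, ?_⟩
  · rw [← turn_conj_gen b hρc]
    change ρ.symm.trans (.trans (Path.Homotopic.Quotient.map (κ.symm.trans (.trans (gen b) κ))
      negMap) ρ) = κ.symm.trans (.trans (ρc.symm.trans (.trans (.map (gen b) negMap) ρc)) κ)
    rw [map_quotient_trans, map_quotient_trans, map_quotient_symm]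
    have e3 : (κ.map negMap).symm.trans (ρc.trans κ) = ρ := by rw [e2]; grind
    have e4 : ρ.symm = (κ.symm.trans ρc.symm).trans (κ.map negMap) := by
      rw [← e3, quotient_trans_symm, quotient_trans_symm]
      grind
    rw [e4, ← e3]
    grind
  · rw [← turn_trans_turn hηc hρc]
    change _ = κ.symm.trans (.trans (ηc.trans ρc) κ)
    grind

theorem ne_zero_of_eq_add {n₁ n₂ : Torus} (hn : n₁ ≠ n₂) {v : ℂ} (hvn : n₂ = n₁ + toTorus v) :
    v ≠ 0 := by
  rintro rfl
  exact hn (by rw [hvn, toTorus_zero, add_zero])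

theorem diffMap_swap (p : Conf Torus) : diffMap (swap p) = negMap (diffMap p) :=
  Subtype.ext (neg_sub _ _).symm

theorem toTorus_eq_diffMap {n₁ n₂ : Torus} (hn : n₁ ≠ n₂) {v : ℂ} (hvn : n₂ = n₁ + toTorus v) :
    toTorus v = diffMap ⟨(n₁, n₂), hn⟩ := by
  subst hvn
  exact (add_sub_cancel_left _ _).symm

section HalfTwistCoordinates

variable {n₁ n₂ : Torus} (hn : n₁ ≠ n₂) {v : ℂ} (hv : ‖v‖ < 1) (hvn : n₂ = n₁ + toTorus v)

theorem diffMap_halfTwistPath (t : I) :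
    (diffMap (halfTwistPath n₁ n₂ hn v hv hvn t) : Torus) = toTorus (rot t * v) := by
  change n₁ + toTorus (v / 2 + rot t * (v / 2)) - (n₁ + toTorus (v / 2 - rot t * (v / 2))) = _
  rw [add_sub_add_left_eq_sub, ← toTorus_sub]
  congr 1
  ring

theorem map_diffMap_halfTwistPath {η : Path.Homotopic.Quotient (diffMap ⟨(n₁, n₂), hn⟩)
      (negMap (diffMap ⟨(n₁, n₂), hn⟩))}
    (hη : η = turn (w := v) rfl (ne_zero_of_eq_add hn hvn) hv (toTorus_eq_diffMap hn hvn)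
      (toTorus_neg_eq (toTorus_eq_diffMap hn hvn))) :
    Path.Homotopic.Quotient.map (.mk (halfTwistPath n₁ n₂ hn v hv hvn)) diffMap =
      η.cast rfl (diffMap_swap _) := by
  subst hη
  refine congrArg Path.Homotopic.Quotient.mk
    (a₁ := (halfTwistPath n₁ n₂ hn v hv hvn).map diffMap.continuous)
    (a₂ := (planarPath (halfTurn _) _ _ _).cast rfl (diffMap_swap _))
    (Path.ext (funext fun t => Subtype.ext ?_))
  exact diffMap_halfTwistPath hn hv hvn t

theorem map_diffMap_halfTwistBack {ρ : Path.Homotopic.Quotient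
      (negMap (diffMap ⟨(n₁, n₂), hn⟩)) (diffMap ⟨(n₁, n₂), hn⟩)}
    (hρ : ρ = turn (w := -v) (w' := v) (neg_neg v).symm
      (neg_ne_zero.2 (ne_zero_of_eq_add hn hvn)) (by rwa [norm_neg])
      (toTorus_neg_eq (toTorus_eq_diffMap hn hvn)) (toTorus_eq_diffMap hn hvn)) :
    (halfTwistBack hn hv hvn).map diffMap = ρ.cast (diffMap_swap _) rfl := by
  subst hρ
  refine congrArg Path.Homotopic.Quotient.mk
    (a₁ := (((halfTwistPath n₁ n₂ hn v hv hvn).map (swapMap Torus).continuous).cast rfl rfl).map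
      diffMap.continuous)
    (a₂ := (planarPath (halfTurn _) _ _ _).cast (diffMap_swap _) rfl)
    (Path.ext (funext fun t => Subtype.ext ?_))
  change (diffMap (swap (halfTwistPath n₁ n₂ hn v hv hvn t)) : Torus) = toTorus (rot t * -v)
  rw [diffMap_swap, mul_neg, toTorus_neg, ← diffMap_halfTwistPath hn hv hvn]
  rfl

/-- In the difference coordinate, conjugation by the half twist is `turnHom`. -/
theorem map_diffMap_conjSigma {ρ : Path.Homotopic.Quotient
      (negMap (diffMap ⟨(n₁, n₂), hn⟩)) (diffMap ⟨(n₁, n₂), hn⟩)}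
    (hρ : ρ = turn (w := -v) (w' := v) (neg_neg v).symm
      (neg_ne_zero.2 (ne_zero_of_eq_add hn hvn)) (by rwa [norm_neg])
      (toTorus_neg_eq (toTorus_eq_diffMap hn hvn)) (toTorus_eq_diffMap hn hvn))
    (g : PureBraid (⟨(n₁, n₂), hn⟩ : Conf Torus)) :
    FundamentalGroup.map diffMap _ (conjSigma hn hv hvn g) =
      turnHom ρ (FundamentalGroup.map diffMap _ g) := by
  have hg : (Path.Homotopic.Quotient.map g (swapMap Torus)).map diffMap =
      ((Path.Homotopic.Quotient.map g diffMap).map negMap).cast (diffMap_swap _)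
        (diffMap_swap _) := by
    induction g using Path.Homotopic.Quotient.ind with | mk γ =>
    exact congrArg Path.Homotopic.Quotient.mk
      (a₁ := (γ.map (swapMap Torus).continuous).map diffMap.continuous)
      (a₂ := ((γ.map diffMap.continuous).map negMap.continuous).cast (diffMap_swap _)
        (diffMap_swap _)) (Path.ext (funext fun t => diffMap_swap _))
  change ((halfTwistBack hn hv hvn).symm.trans (.trans
    (Path.Homotopic.Quotient.map g (swapMap Torus))
    (halfTwistBack hn hv hvn))).map diffMap = ρ.symm.trans
      (.trans ((Path.Homotopic.Quotient.map g diffMap).map negMap) ρ)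
  rw [map_quotient_trans, map_quotient_trans, map_quotient_symm,
    map_diffMap_halfTwistBack hn hv hvn hρ]
  refine (congrArg (fun x => Path.Homotopic.Quotient.trans _ (Path.Homotopic.Quotient.trans x _))
    hg).trans ?_
  have key : ∀ {p p' q : PuncturedTorus} (h : p' = p) (α : Path.Homotopic.Quotient p q)
      (β : Path.Homotopic.Quotient p p), (α.cast h rfl).symm.trans
        ((β.cast h h).trans (α.cast h rfl)) = α.symm.trans (β.trans α) := by
    rintro p _ q rfl α β
    simp only [Path.Homotopic.Quotient.cast_rfl_rfl]
  exact key _ _ _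

theorem map_diffMap_fullTwist {η : Path.Homotopic.Quotient (diffMap ⟨(n₁, n₂), hn⟩)
      (negMap (diffMap ⟨(n₁, n₂), hn⟩))} {ρ : Path.Homotopic.Quotient
      (negMap (diffMap ⟨(n₁, n₂), hn⟩)) (diffMap ⟨(n₁, n₂), hn⟩)}
    (hη : η = turn (w := v) rfl (ne_zero_of_eq_add hn hvn) hv (toTorus_eq_diffMap hn hvn)
      (toTorus_neg_eq (toTorus_eq_diffMap hn hvn)))
    (hρ : ρ = turn (w := -v) (w' := v) (neg_neg v).symm
      (neg_ne_zero.2 (ne_zero_of_eq_add hn hvn)) (by rwa [norm_neg])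
      (toTorus_neg_eq (toTorus_eq_diffMap hn hvn)) (toTorus_eq_diffMap hn hvn)) :
    FundamentalGroup.map diffMap _ (fullTwist hn hv hvn) = η.trans ρ := by
  change (Path.Homotopic.Quotient.trans (.mk (halfTwistPath n₁ n₂ hn v hv hvn))
    (halfTwistBack hn hv hvn)).map diffMap = _
  refine (map_quotient_trans _ _ _).trans ?_
  rw [map_diffMap_halfTwistPath hn hv hvn hη]
  refine (congrArg (Path.Homotopic.Quotient.trans _)
    (map_diffMap_halfTwistBack hn hv hvn hρ)).trans ?_
  have key : ∀ {p q r s : PuncturedTorus} (h : s = q) (α : Path.Homotopic.Quotient p q)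
      (β : Path.Homotopic.Quotient q r), (α.cast rfl h).trans (β.cast h rfl) = α.trans β := by
    rintro p _ r q rfl α β
    simp only [Path.Homotopic.Quotient.cast_rfl_rfl]
  exact key _ _ _

/-- Conjugation by the half twist exchanges the two strands; on the first strand it adds the
displacement of the difference. -/
theorem disp_firstPointHom_conjSigma (g : PureBraid (⟨(n₁, n₂), hn⟩ : Conf Torus)) :
    disp (firstPointHom _ (conjSigma hn hv hvn g)) = disp (firstPointHom _ g) +
      disp (Path.Homotopic.Quotient.map (FundamentalGroup.map diffMap _ g) puncturedIncl) := by
  refine Eq.trans ?_ (disp_secondPoint (FundamentalGroup.toPath g))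
  change disp (((halfTwistBack hn hv hvn).symm.trans
    (.trans (Path.Homotopic.Quotient.map g (swapMap Torus)) (halfTwistBack hn hv hvn))).map
      (firstPoint Torus)) = _
  rw [map_quotient_trans, map_quotient_trans, map_quotient_symm, disp_trans, disp_trans, disp_symm]
  have hg : (Path.Homotopic.Quotient.map g (swapMap Torus)).map (firstPoint Torus) =
      Path.Homotopic.Quotient.map g secondPoint := by
    induction g using Path.Homotopic.Quotient.ind with | mk γ => rfl
  rw [hg]
  exact neg_add_cancel_comm_assoc _ _

theorem disp_firstPointHom_fullTwist :
    disp (firstPointHom _ (fullTwist hn hv hvn)) = 0 := by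
  have hr := continuous_rot
  obtain ⟨z, hz⟩ := isOpenQuotientMap_toTorus.surjective n₁
  have h1 : disp ((Path.Homotopic.Quotient.mk (halfTwistPath n₁ n₂ hn v hv hvn)).map
      (firstPoint Torus)) = z + v - z := by
    refine disp_mk (γ := (halfTwistPath n₁ n₂ hn v hv hvn).map (firstPoint Torus).continuous)
      ⟨⟨fun t => z + (v / 2 - rot t * (v / 2)), by fun_prop⟩, by simp [rot_zero],
        by simp [rot_one]⟩ fun t => ?_
    change toTorus (z + (v / 2 - rot t * (v / 2))) = n₁ + toTorus (v / 2 - rot t * (v / 2))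
    rw [toTorus_add, hz]
  have h2 : disp ((halfTwistBack hn hv hvn).map (firstPoint Torus)) = z - (z + v) := by
    refine disp_mk (γ := (((halfTwistPath n₁ n₂ hn v hv hvn).map
      (swapMap Torus).continuous).cast rfl rfl).map (firstPoint Torus).continuous)
      ⟨⟨fun t => z + (v / 2 + rot t * (v / 2)), by fun_prop⟩, by simp [rot_zero],
        by simp [rot_one]⟩ fun t => ?_
    change toTorus (z + (v / 2 + rot t * (v / 2))) = n₁ + toTorus (v / 2 + rot t * (v / 2))
    rw [toTorus_add, hz]
  change disp ((Path.Homotopic.Quotient.trans (.mk (halfTwistPath n₁ n₂ hn v hv hvn))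
    (halfTwistBack hn hv hvn)).map (firstPoint Torus)) = 0
  refine (congrArg disp (map_quotient_trans _ _ _)).trans ((disp_trans _ _).trans ?_)
  refine (congrArg₂ (· + ·) h1 h2).trans ?_
  ring

end HalfTwistCoordinates

end TorusBraid

end

theorem mainTheorem9 (n₁ n₂ : Torus) (hn : n₁ ≠ n₂)
    (v : ℂ) (hv : ‖v‖ < 1) (hvn : n₂ = n₁ + toTorus v) :
    let n : Conf Torus := ⟨(n₁, n₂), hn⟩
    let σ : FullBraid n := sigma n₁ n₂ hn v hv hvn
    let ι : PureBraid n →* FullBraid n := pureToFull n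
    let x : FreeGroup (Fin 2) := FreeGroup.of 0
    let y : FreeGroup (Fin 2) := FreeGroup.of 1
    let B : FreeGroup (Fin 2) := x * y⁻¹ * x⁻¹ * y
    let s : Multiplicative ℤ := Multiplicative.ofAdd 1
    Function.Injective ι ∧
    ∃ (ψ : FundamentalGroup Torus n₁ ≃* Multiplicative ℤ × Multiplicative ℤ)
      (φ : PureBraid n ≃* FreeGroup (Fin 2) × Multiplicative ℤ × Multiplicative ℤ)
      (lσ : PureBraid n →* PureBraid n),
      ψ (latticeLoop n₁ 1 toTorus_one) = (s, 1) ∧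
      ψ (latticeLoop n₁ Complex.I toTorus_I) = (1, s) ∧
      (∀ g : PureBraid n, ψ (firstPointHom n g) = (φ g).2) ∧
      σ ∉ ι.range ∧
      σ ^ 2 = ι (φ.symm (B, 1, 1)) ∧
      (∀ g : PureBraid n, ι (lσ g) = σ * ι g * σ⁻¹) ∧
      lσ (φ.symm (x, 1, 1)) = φ.symm (B * x⁻¹, s, 1) ∧
      lσ (φ.symm (y, 1, 1)) = φ.symm (B * y⁻¹, 1, s) ∧
      lσ (φ.symm (1, s, 1)) = φ.symm (1, s, 1) ∧
      lσ (φ.symm (1, 1, s)) = φ.symm (1, 1, s) := by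
  intro n σ ι x y B s
  obtain ⟨η, hη⟩ : ∃ η, η = turn (w := v) rfl (ne_zero_of_eq_add hn hvn) hv
    (toTorus_eq_diffMap hn hvn) (toTorus_neg_eq (toTorus_eq_diffMap hn hvn)) := ⟨_, rfl⟩
  obtain ⟨ρ, hρ⟩ : ∃ ρ, ρ = turn (w := -v) (w' := v) (neg_neg v).symm
    (neg_ne_zero.2 (ne_zero_of_eq_add hn hvn)) (by rwa [norm_neg])
    (toTorus_neg_eq (toTorus_eq_diffMap hn hvn)) (toTorus_eq_diffMap hn hvn) := ⟨_, rfl⟩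
  obtain ⟨κ, hκ, hκB⟩ := exists_conj_turn (toTorus_eq_diffMap hn hvn) (ne_zero_of_eq_add hn hvn)
    hv hη hρ
  let Φ : FreeGroup (Fin 2) ≃* FundamentalGroup PuncturedTorus (diffMap n) :=
    ((FreeGroup.freeGroupCongr finTwoEquiv).trans freeEquiv).trans (conjEquiv κ)
  have hx : Φ x = conjEquiv κ (gen false) := congrArg (conjEquiv κ) (freeEquiv_of false)
  have hy : Φ y = conjEquiv κ (gen true) := congrArg (conjEquiv κ) (freeEquiv_of true)
  let ψ := torusGroupEquiv n₁
  let φ : PureBraid n ≃* FreeGroup (Fin 2) × Multiplicative ℤ × Multiplicative ℤ :=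
    (pureBraidEquiv n).trans (Φ.symm.prodCongr ψ)
  have hφ1 : ∀ g w, (φ g).1 = w ↔ FundamentalGroup.map diffMap n g = Φ w :=
    fun g w => Φ.symm_apply_eq
  have hφ2 : ∀ g, (φ g).2 = ψ (firstPointHom n g) := fun _ => rfl
  -- the effect of conjugation by `σ` in the coordinates `φ`
  have key : ∀ (w w' : FreeGroup (Fin 2)) (k l k' l' : ℤ),
      turnHom ρ (Φ w) = Φ w' →
      disp (Path.Homotopic.Quotient.map (Φ w) puncturedIncl) = k' + l' * Complex.I →
      conjSigma hn hv hvn (φ.symm (w, .ofAdd k, .ofAdd l)) =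
        φ.symm (w', .ofAdd (k + k'), .ofAdd (l + l')) := by
    intro w w' k l k' l' hw hd
    set g := φ.symm (w, .ofAdd k, .ofAdd l) with hg
    have hφg : φ g = (w, .ofAdd k, .ofAdd l) := φ.apply_symm_apply _
    have h1 := (hφ1 g w).1 (by rw [hφg])
    have h2 := disp_eq_of_torusGroupEquiv ((hφ2 g).symm.trans (by rw [hφg]))
    rw [MulEquiv.eq_symm_apply]
    refine Prod.ext ((hφ1 _ _).2 ?_) ((hφ2 _).trans (torusGroupEquiv_eq_of_disp ?_))
    · rw [map_diffMap_conjSigma hn hv hvn hρ]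
      exact (congrArg _ h1).trans hw
    · rw [disp_firstPointHom_conjSigma hn hv hvn]
      refine (congrArg₂ (· + ·) h2 ((congrArg (fun u => disp
        (Path.Homotopic.Quotient.map u puncturedIncl)) h1).trans hd)).trans ?_
      push_cast
      ring
  have hdisp : ∀ b, disp (Path.Homotopic.Quotient.map (conjEquiv κ (gen b)) puncturedIncl) =
      dir b := fun b => (disp_puncturedIncl_conj κ (gen b)).trans (disp_puncturedIncl_gen b)
  have hdisp1 : disp (Path.Homotopic.Quotient.map (Φ 1) puncturedIncl) =
      (0 : ℤ) + (0 : ℤ) * Complex.I := by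
    rw [map_one]
    exact (disp_refl _).trans (by simp)
  have hturn1 : turnHom ρ (Φ 1) = Φ 1 := by rw [map_one, map_one]
  refine ⟨pureToFull_injective n, ψ, φ, conjSigma hn hv hvn, ?_, ?_, fun g => rfl,
    sigma_notMem_range hn hv hvn, ?_, pureToFull_conjSigma hn hv hvn, ?_, ?_, ?_, ?_⟩
  · refine torusGroupEquiv_eq_of_disp (m := 1) (n := 0) ?_
    rw [disp_latticeLoop]
    simp
  · refine torusGroupEquiv_eq_of_disp (m := 0) (n := 1) ?_
    rw [disp_latticeLoop]
    simp
  · rw [← pureToFull_fullTwist hn hv hvn]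
    congr 1
    rw [MulEquiv.eq_symm_apply]
    refine Prod.ext ((hφ1 _ _).2 ?_) ((hφ2 _).trans
      (torusGroupEquiv_eq_of_disp (m := 0) (n := 0) ?_))
    · rw [map_diffMap_fullTwist hn hv hvn hη hρ]
      refine hκB.trans ?_
      simp only [B, map_mul, map_inv, hx, hy]
    · rw [disp_firstPointHom_fullTwist]
      simp
  · refine key x (B * x⁻¹) 0 0 1 0 ?_ ?_
    · rw [hx, hκ]
      simp only [B, map_mul, map_inv, hx, hy]
      group
    · rw [hx, hdisp]
      simp [dir]
  · refine key y (B * y⁻¹) 0 0 0 1 ?_ ?_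
    · rw [hy, hκ]
      simp only [B, map_mul, map_inv, hx, hy]
      group
    · rw [hy, hdisp]
      simp [dir]
  · exact key 1 1 1 0 0 0 hturn1 hdisp1
  · exact key 1 1 0 1 0 0 hturn1 hdisp1
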